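/- Let \(u,v,w\) be three scalar fields depending on the two independent variables \(x,y\). Let \(U\subseteq\mathbb R^3\) be a connected open set of values of \((u,v,w)\), let \(f_1,f_2,f_3:U\to\mathbb R\) be \(C^\infty\) functions of \((u,v,w)\), and let \(\lambda\in\mathbb R\) be a constant. Put \[ P_3=\begin{pmatrix}0&0&1\\0&1&0\\1&0&0\end{pmatrix}\frac{d}{dx}+\begin{pmatrix}-2v&w&\lambda\\w&\lambda&0\\\lambda&0&0\end{pmatrix}\frac{d}{dy}+\begin{pmatrix}-v_y&2w_y&0\\-w_y&0&0\\0&0&0\end{pmatrix}, \] \[ P_4=\begin{pmatrix}0&0&1\\0&1&0\\1&0&0\end{pmatrix}\frac{d}{dx}+\begin{pmatrix}-2u&-\frac12v&w\\-\frac12v&w&0\\w&0&0\end{pmatrix}\frac{d}{dy}+\begin{pmatrix}-u_y&\frac12v_y&2w_y\\-v_y&\frac12w_y&0\\-w_y&0&0\end{pmatrix}, \qquad \omega=\begin{pmatrix}0&f_1&f_2\\-f_1&0&f_3\\-f_2&-f_3&0\end{pmatrix}. \] A differential operator \(Q=(Q^{ij})\) is called Hamiltonian (over \(U\)) if the bracket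 \[\{F,G\}=\int\frac{\delta F}{\delta u^i}\,Q^{ij}\,\frac{\delta G}{\delta u^j}\,dx\,dy\] on local functionals \(F=\int f\,dx\,dy\) is skew-symmetric and satisfies the Jacobi identity. Here \(f\) is a smooth function of \(x,y\), of the fields \((u^1,u^2,u^3)=(u,v,w)\) with values in \(U\), and of finitely many of their derivatives, and functionals are identified when their densities differ by a total divergence. Then: 1. \(P_3+\omega\) is Hamiltonian if and only if there are constants \(c,c_1\in\mathbb R\) such that \(f_1=c\,u+c_1\), \(f_2=-c\,v\) and \(f_3=c\,w\) on \(U\). 2. \(P_4+\omega\) is Hamiltonian if and only if \(f_1=f_2=f_3=0\) on \(U\). -/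

import Mathlib

open scoped ContDiff

noncomputable section

namespace Hydro

/-- Coordinates on the infinite jet space of maps `(x, y) ↦ (u, v, w)`: the two independent
variables, and for each field `i` the variable `jet i a b` standing for `∂ₓᵃ ∂_yᵇ uⁱ`. -/
inductive Coord : Type
  | x : Coord
  | y : Coord
  | jet : Fin 3 → ℕ → ℕ → Coord
  deriving DecidableEq

/-- A point of the infinite jet space. -/
abbrev Jet : Type := Coord → ℝ

/-- The values `(u, v, w)` of the fields at a point of the jet space. -/
def fields (z : Jet) : Fin 3 → ℝ := fun i => z (.jet i 0 0)

/-- The jets whose field values lie in `U`. -/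
def jetDomain (U : Set (Fin 3 → ℝ)) : Set Jet := {z | fields z ∈ U}

/-- Differential functions over `U`: they depend on finitely many jet coordinates, and smoothly so
over `U`. The values outside `jetDomain U` are never used. -/
def IsDiffFun (U : Set (Fin 3 → ℝ)) (f : Jet → ℝ) : Prop :=
  ∃ (s : Finset Coord) (g : (s → ℝ) → ℝ),
    ContDiffOn ℝ ∞ g (s.restrict '' jetDomain U) ∧ ∀ z : Jet, f z = g (s.restrict z)

/-- Partial derivative with respect to one jet coordinate. -/
def partialD (c : Coord) (f : Jet → ℝ) : Jet → ℝ :=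
  fun z => deriv (fun t : ℝ => f (Function.update z c t)) (z c)

/-- Total derivative `d/dx` (for a differential function only finitely many terms are nonzero). -/
def totalDx (f : Jet → ℝ) : Jet → ℝ := fun z =>
  partialD .x f z +
    ∑ᶠ J : Fin 3 × ℕ × ℕ,
      z (.jet J.1 (J.2.1 + 1) J.2.2) * partialD (.jet J.1 J.2.1 J.2.2) f z

/-- Total derivative `d/dy`. -/
def totalDy (f : Jet → ℝ) : Jet → ℝ := fun z =>
  partialD .y f z +
    ∑ᶠ J : Fin 3 × ℕ × ℕ,
      z (.jet J.1 J.2.1 (J.2.2 + 1)) * partialD (.jet J.1 J.2.1 J.2.2) f z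

/-- Variational derivative `δ/δuⁱ` of the functional `∫ f dx dy`:
`∑ (-1)^(a+b) (d/dx)^a (d/dy)^b (∂f/∂uⁱ_{ab})`. -/
def varDeriv (i : Fin 3) (f : Jet → ℝ) : Jet → ℝ := fun z =>
  ∑ᶠ ab : ℕ × ℕ,
    (-1 : ℝ) ^ (ab.1 + ab.2) * totalDx^[ab.1] (totalDy^[ab.2] (partialD (.jet i ab.1 ab.2) f)) z

/-- `f` is a total divergence over `U`, that is, the local functional `∫ f dx dy` is zero. -/
def IsTotalDivergence (U : Set (Fin 3 → ℝ)) (f : Jet → ℝ) : Prop :=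
  ∃ A B : Jet → ℝ, IsDiffFun U A ∧ IsDiffFun U B ∧
    ∀ z ∈ jetDomain U, f z = totalDx A z + totalDy B z

/-- Matrix operators, acting on triples of differential functions. -/
abbrev Operator : Type := (Fin 3 → Jet → ℝ) → (Fin 3 → Jet → ℝ)

/-- The first-order operator `g₁ d/dx + g₂ d/dy + b`. -/
def firstOrderOp (g₁ g₂ b : Jet → Matrix (Fin 3) (Fin 3) ℝ) : Operator := fun ψ i z =>
  ∑ j, (g₁ z i j * totalDx (ψ j) z + g₂ z i j * totalDy (ψ j) z + b z i j * ψ j z)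

/-- The density `∑ δf/δuⁱ P^{ij} δg/δuʲ` of the bracket of `∫ f dx dy` and `∫ g dx dy`. -/
def bracket (P : Operator) (f g : Jet → ℝ) : Jet → ℝ := fun z =>
  ∑ i, varDeriv i f z * P (fun j => varDeriv j g) i z

/-- `P` is a Hamiltonian operator over `U`: its bracket on local functionals (densities modulo total
divergences) is skew-symmetric and satisfies the Jacobi identity. -/
def IsHamiltonian (U : Set (Fin 3 → ℝ)) (P : Operator) : Prop :=
  (∀ f g, IsDiffFun U f → IsDiffFun U g →
    IsTotalDivergence U (bracket P f g + bracket P g f)) ∧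
  (∀ f g h, IsDiffFun U f → IsDiffFun U g → IsDiffFun U h →
    IsTotalDivergence U
      (bracket P (bracket P f g) h + bracket P (bracket P g h) f + bracket P (bracket P h f) g))

/-- The operator `P₃`, with parameter `lam`. -/
def P₃ (lam : ℝ) : Operator :=
  firstOrderOp
    (fun _ => !![0, 0, 1; 0, 1, 0; 1, 0, 0])
    (fun z =>
      let v := z (.jet 1 0 0)
      let w := z (.jet 2 0 0)
      !![-2 * v, w, lam; w, lam, 0; lam, 0, 0])
    (fun z =>
      let v_y := z (.jet 1 0 1)
      let w_y := z (.jet 2 0 1)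
      !![-v_y, 2 * w_y, 0; -w_y, 0, 0; 0, 0, 0])

/-- The operator `P₄`. -/
def P₄ : Operator :=
  firstOrderOp
    (fun _ => !![0, 0, 1; 0, 1, 0; 1, 0, 0])
    (fun z =>
      let u := z (.jet 0 0 0)
      let v := z (.jet 1 0 0)
      let w := z (.jet 2 0 0)
      !![-2 * u, -(1 / 2) * v, w; -(1 / 2) * v, w, 0; w, 0, 0])
    (fun z =>
      let u_y := z (.jet 0 0 1)
      let v_y := z (.jet 1 0 1)
      let w_y := z (.jet 2 0 1)
      !![-u_y, (1 / 2) * v_y, 2 * w_y; -v_y, (1 / 2) * w_y, 0; -w_y, 0, 0])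

/-- The skew ultralocal (order zero) operator with entries `f₁, f₂, f₃`, functions of `(u, v, w)`. -/
def ultralocal (f₁ f₂ f₃ : (Fin 3 → ℝ) → ℝ) : Operator := fun ψ i z =>
  let q := fields z
  (!![0, f₁ q, f₂ q; -f₁ q, 0, f₃ q; -f₂ q, -f₃ q, 0] : Matrix (Fin 3) (Fin 3) ℝ).mulVec
    (fun j => ψ j z) i

end Hydro

end

/-!
The differential functions over `U` form a commutative algebra `DiffAlg U` with commuting partial
derivatives `pd c`, one for each jet coordinate. A vector field `vf X` on the jet space is a
derivation of this algebra, and the commutator of two vector fields is the vector field with the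
expected coefficients (`vf_comm`). Total derivatives and evolutionary fields `pr φ` are vector
fields, so this one formula shows that `Dx`, `Dy` and `pr φ` commute as they should. It also makes
the sum that defines a variational derivative of a total derivative telescope to zero (`euler_Dx`,
`euler_Dy`).

Modulo divergences, `pr φ f` is the pairing of `φ` with the variational gradient of `f`
(`functional_pr`). Applied twice, this gives the symmetry of second variations
(`functional_second_variation`). For a skew-adjoint operator `P` the symmetry cancels all terms of
the Jacobi identity in which gradients are differentiated. What remains is the Schouten bracket
`[P, P]`, a trilinear expression in the gradients (`SkewAdjoint.functional_jacobi`). The operators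
`P₃ + ω` and `P₄ + ω` are skew-adjoint for every `ω`. So they are Hamiltonian if and only if
`[P, P](δF, δG, δH)` is a divergence for all `F`, `G`, `H`.

Sufficiency: for `ω` as in the theorem, `[P, P](ξ, η, ζ)` is written as an explicit divergence for
arbitrary `ξ, η, ζ` (`functional_trivector_P₃`, `functional_trivector_P₄`).

Necessity: take `F = ½ ∫ (uⁱ - qᵢ)²`, `G = ∫ uʲ`, `H = ∫ (a x + e y) uᵏ`, and evaluate the `i`-th
variational derivative of `[P, P](δF, δG, δH)`, which has to vanish, at the constant state `q`.
As `uⁱ - qᵢ` vanishes there with all its total derivatives, only the factor it multiplies survives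
(`ev_euler_shift_mul`). The result is a linear relation between `ω` and its first derivatives at `q`
(`Autonomous.compatibility`). The relations from the `d/dx` part say that `f₁, f₂, f₃` depend only
on `u`, `v`, `w`, respectively, and that `f₁' = f₃' = -f₂'`; hence this common value is a constant
`c`. The relations from the `d/dy` part fix the constants of integration for `P₃`, and force
`ω = 0` for `P₄`.
-/

noncomputable section

namespace Hydro

open TopologicalSpace Topology

/-! ### Differential functions and their partial derivatives -/

/-- The coordinates `u, v, w` themselves. A finite set of coordinates is enlarged by these to make
the image of the jet domain open. -/
def fieldCoords : Finset Coord := Finset.univ.image fun i : Fin 3 => Coord.jet i 0 0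

lemma mem_fieldCoords (i : Fin 3) : Coord.jet i 0 0 ∈ fieldCoords :=
  Finset.mem_image_of_mem _ (Finset.mem_univ i)

lemma restrict_image_jetDomain (U : Set (Fin 3 → ℝ)) {s : Finset Coord} (hs : fieldCoords ⊆ s) :
    s.restrict '' jetDomain U =
      {w : s → ℝ | (fun i : Fin 3 => w ⟨.jet i 0 0, hs (mem_fieldCoords i)⟩) ∈ U} := by
  ext w
  constructor
  · rintro ⟨z, hz, rfl⟩
    exact hz
  · intro hw
    have hr : s.restrict (fun c => if h : c ∈ s then w ⟨c, h⟩ else (0 : ℝ)) = w := by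
      ext c
      simp
    refine ⟨_, ?_, hr⟩
    have hf : fields (fun c => if h : c ∈ s then w ⟨c, h⟩ else (0 : ℝ)) =
        fun i => w ⟨.jet i 0 0, hs (mem_fieldCoords i)⟩ :=
      funext fun i => dif_pos (hs (mem_fieldCoords i))
    change fields _ ∈ U
    rw [hf]
    exact hw

lemma isOpen_restrict_image {U : Set (Fin 3 → ℝ)} (hU : IsOpen U) {s : Finset Coord}
    (hs : fieldCoords ⊆ s) : IsOpen (s.restrict '' jetDomain U) := by
  rw [restrict_image_jetDomain U hs]
  exact hU.preimage (by fun_prop)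

/-- A differential function can be expressed through any sufficiently large set of coordinates. -/
lemma IsDiffFun.exists_superset {U : Set (Fin 3 → ℝ)} {F : Jet → ℝ} (h : IsDiffFun U F)
    (t : Finset Coord) :
    ∃ s : Finset Coord, t ⊆ s ∧ fieldCoords ⊆ s ∧ ∃ g : (s → ℝ) → ℝ,
      ContDiffOn ℝ ∞ g (s.restrict '' jetDomain U) ∧ ∀ z, F z = g (s.restrict z) := by
  obtain ⟨s, g, hg, hF⟩ := h
  have hs : s ⊆ s ∪ (t ∪ fieldCoords) := Finset.subset_union_left
  refine ⟨s ∪ (t ∪ fieldCoords), fun _ h => by simp [h], fun _ h => by simp [h],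
    fun w => g fun d => w ⟨d.1, hs d.2⟩, ?_, fun z => hF z⟩
  refine hg.comp (contDiff_pi.2 fun i => contDiff_apply ℝ ℝ _).contDiffOn ?_
  rintro _ ⟨z, hz, rfl⟩
  exact ⟨z, hz, rfl⟩

lemma isDiffFun_const (U : Set (Fin 3 → ℝ)) (a : ℝ) : IsDiffFun U fun _ => a :=
  ⟨∅, fun _ => a, contDiffOn_const, fun _ => rfl⟩

lemma isDiffFun_coord (U : Set (Fin 3 → ℝ)) (c : Coord) : IsDiffFun U fun z => z c :=
  ⟨{c}, fun w => w ⟨c, by simp⟩, (contDiff_apply ℝ ℝ _).contDiffOn, fun _ => rfl⟩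

lemma isDiffFun_comp_fields {U : Set (Fin 3 → ℝ)} {f : (Fin 3 → ℝ) → ℝ} (hf : ContDiffOn ℝ ∞ f U) :
    IsDiffFun U fun z => f (fields z) := by
  refine ⟨fieldCoords, fun w => f fun i => w ⟨_, mem_fieldCoords i⟩, ?_, fun _ => rfl⟩
  refine hf.comp (contDiff_pi.2 fun i => contDiff_apply ℝ ℝ _).contDiffOn ?_
  rintro _ ⟨z, hz, rfl⟩
  exact hz

lemma IsDiffFun.comp₂ {U : Set (Fin 3 → ℝ)} {F G : Jet → ℝ} (hF : IsDiffFun U F)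
    (hG : IsDiffFun U G) {m : ℝ × ℝ → ℝ} (hm : ContDiff ℝ ∞ m) :
    IsDiffFun U fun z => m (F z, G z) := by
  obtain ⟨s, g, hg, hFg⟩ := hF
  obtain ⟨t, hst, -, k, hk, hGk⟩ := hG.exists_superset s
  refine ⟨t, fun w => m (g fun d => w ⟨d.1, hst d.2⟩, k w), ?_, fun z => ?_⟩
  · refine hm.comp_contDiffOn (ContDiffOn.prodMk ?_ hk)
    refine hg.comp (contDiff_pi.2 fun i => contDiff_apply ℝ ℝ _).contDiffOn ?_
    rintro _ ⟨z, hz, rfl⟩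
    exact ⟨z, hz, rfl⟩
  · simp only [hFg, hGk]
    rfl

lemma update_mem_jetDomain {U : Set (Fin 3 → ℝ)} (hU : IsOpen U) {z : Jet} (hz : z ∈ jetDomain U)
    (c : Coord) : ∀ᶠ t in 𝓝 (z c), Function.update z c t ∈ jetDomain U := by
  have hc : Continuous fun t : ℝ => fields (Function.update z c t) := by
    unfold fields
    fun_prop
  refine hc.continuousAt.eventually_mem (hU.mem_nhds ?_)
  simpa [jetDomain] using hz

lemma partialD_congr {U : Set (Fin 3 → ℝ)} (hU : IsOpen U) {F G : Jet → ℝ}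
    (h : ∀ z ∈ jetDomain U, F z = G z) (c : Coord) {z : Jet} (hz : z ∈ jetDomain U) :
    partialD c F z = partialD c G z :=
  Filter.EventuallyEq.deriv_eq ((update_mem_jetDomain hU hz c).mono fun _ ht => h _ ht)

lemma partialD_of_notMem {s : Finset Coord} {F : Jet → ℝ} {g : (s → ℝ) → ℝ}
    (hF : ∀ z, F z = g (s.restrict z)) {c : Coord} (hc : c ∉ s) (z : Jet) :
    partialD c F z = 0 := by
  have : (fun t : ℝ => F (Function.update z c t)) = fun _ => F z := by
    ext t
    rw [hF, hF]
    congr 1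
    ext d
    exact Function.update_of_ne (fun h => hc (by rw [← h]; exact d.2)) _ _
  simp [partialD, this]

lemma restrict_update {s : Finset Coord} (z : Jet) {c : Coord} (hc : c ∈ s) (t : ℝ) :
    s.restrict (Function.update z c t) = Function.update (s.restrict z) ⟨c, hc⟩ t := by
  ext d
  by_cases h : d = ⟨c, hc⟩
  · subst h
    simp
  · have : d.1 ≠ c := fun h' => h (Subtype.ext h')
    simp [h, this]

lemma hasDerivAt_jet_update {U : Set (Fin 3 → ℝ)} (hU : IsOpen U) {s : Finset Coord}
    (hs : fieldCoords ⊆ s) {F : Jet → ℝ} {g : (s → ℝ) → ℝ}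
    (hg : ContDiffOn ℝ ∞ g (s.restrict '' jetDomain U)) (hF : ∀ z, F z = g (s.restrict z))
    {c : Coord} (hc : c ∈ s) {z : Jet} (hz : z ∈ jetDomain U) :
    HasDerivAt (fun t => F (Function.update z c t))
      (fderiv ℝ g (s.restrict z) (Pi.single ⟨c, hc⟩ 1)) (z c) := by
  have hd : HasFDerivAt g (fderiv ℝ g (s.restrict z))
      (Function.update (s.restrict z) ⟨c, hc⟩ (z c)) := by
    rw [← restrict_update, Function.update_eq_self]
    exact ((hg.contDiffAt ((isOpen_restrict_image hU hs).mem_nhds ⟨z, hz, rfl⟩)).differentiableAt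
      (by simp)).hasFDerivAt
  have := hd.comp_hasDerivAt (z c) (hasDerivAt_update (s.restrict z) ⟨c, hc⟩ (z c))
  refine this.congr_of_eventuallyEq (Filter.Eventually.of_forall fun t => ?_)
  simp only [hF, restrict_update z hc, Function.comp]

lemma partialD_eq_fderiv {U : Set (Fin 3 → ℝ)} (hU : IsOpen U) {s : Finset Coord}
    (hs : fieldCoords ⊆ s) {F : Jet → ℝ} {g : (s → ℝ) → ℝ}
    (hg : ContDiffOn ℝ ∞ g (s.restrict '' jetDomain U)) (hF : ∀ z, F z = g (s.restrict z))
    {c : Coord} (hc : c ∈ s) {z : Jet} (hz : z ∈ jetDomain U) :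
    partialD c F z = fderiv ℝ g (s.restrict z) (Pi.single ⟨c, hc⟩ 1) :=
  (hasDerivAt_jet_update hU hs hg hF hc hz).deriv

lemma contDiffOn_fderiv_apply {E : Type*} [NormedAddCommGroup E] [NormedSpace ℝ E]
    {g : E → ℝ} {V : Set E} (hV : IsOpen V) (hg : ContDiffOn ℝ ∞ g V) (e : E) :
    ContDiffOn ℝ ∞ (fun w => fderiv ℝ g w e) V :=
  (hg.fderiv_of_isOpen hV (by simp)).clm_apply contDiffOn_const

/-- Second derivatives of a smooth function on an open set are symmetric. -/
lemma fderiv_fderiv_comm {E : Type*} [NormedAddCommGroup E] [NormedSpace ℝ E]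
    {g : E → ℝ} {V : Set E} (hV : IsOpen V) (hg : ContDiffOn ℝ ∞ g V) (e e' : E) {w : E}
    (hw : w ∈ V) :
    fderiv ℝ (fun w => fderiv ℝ g w e) w e' = fderiv ℝ (fun w => fderiv ℝ g w e') w e := by
  have hd : DifferentiableAt ℝ (fderiv ℝ g) w :=
    ((hg.fderiv_of_isOpen (m := ∞) hV (by simp)).contDiffAt (hV.mem_nhds hw)).differentiableAt
      (by simp)
  have hs := (hg.contDiffAt (hV.mem_nhds hw)).isSymmSndFDerivAt
    (by simpa using (WithTop.coe_le_coe.2 le_top : ((2 : ℕ∞) : WithTop ℕ∞) ≤ ∞))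
  rw [fderiv_clm_apply hd (differentiableAt_const _), fderiv_clm_apply hd (differentiableAt_const _)]
  simpa using hs e' e

lemma partialD_eq_comp {s : Finset Coord} {F : Jet → ℝ} {g : (s → ℝ) → ℝ}
    (hF : ∀ z, F z = g (s.restrict z)) {c : Coord} (hc : c ∈ s) (z : Jet) :
    partialD c F z =
      deriv (fun t => g (Function.update (s.restrict z) ⟨c, hc⟩ t)) (s.restrict z ⟨c, hc⟩) := by
  simp only [partialD, hF, restrict_update z hc]
  rfl

lemma isDiffFun_partialD {U : Set (Fin 3 → ℝ)} (hU : IsOpen U) {F : Jet → ℝ} (h : IsDiffFun U F)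
    (c : Coord) : IsDiffFun U (partialD c F) := by
  obtain ⟨s, hc, hs, g, hg, hF⟩ := h.exists_superset {c}
  rw [Finset.singleton_subset_iff] at hc
  refine ⟨s, fun w => deriv (fun t => g (Function.update w ⟨c, hc⟩ t)) (w ⟨c, hc⟩), ?_,
    partialD_eq_comp hF hc⟩
  refine (contDiffOn_fderiv_apply (isOpen_restrict_image hU hs) hg
    (Pi.single ⟨c, hc⟩ 1)).congr ?_
  rintro _ ⟨z, hz, rfl⟩
  rw [← partialD_eq_fderiv hU hs hg hF hc hz, partialD_eq_comp hF hc]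

lemma partialD_comm {U : Set (Fin 3 → ℝ)} (hU : IsOpen U) {F : Jet → ℝ} (h : IsDiffFun U F)
    (c d : Coord) {z : Jet} (hz : z ∈ jetDomain U) :
    partialD c (partialD d F) z = partialD d (partialD c F) z := by
  obtain ⟨s, hcd, hs, g, hg, hF⟩ := h.exists_superset {c, d}
  have hc : c ∈ s := hcd (by simp)
  have hd : d ∈ s := hcd (by simp)
  have hV := isOpen_restrict_image hU hs
  have key : ∀ {c d : Coord} (hc : c ∈ s) (hd : d ∈ s),
      partialD c (partialD d F) z =
        fderiv ℝ (fun w => fderiv ℝ g w (Pi.single ⟨d, hd⟩ 1)) (s.restrict z)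
          (Pi.single ⟨c, hc⟩ 1) := by
    intro c d hc hd
    rw [partialD_congr hU (fun z hz => partialD_eq_fderiv hU hs hg hF hd hz) c hz]
    exact partialD_eq_fderiv hU hs (contDiffOn_fderiv_apply hV hg (Pi.single ⟨d, hd⟩ 1))
      (fun _ => rfl) hc hz
  rw [key hc hd, key hd hc]
  exact fderiv_fderiv_comm hV hg _ _ ⟨z, hz, rfl⟩

/-- The differential functions over `U`, as functions on the part of the jet space where they are
meaningful, form a subalgebra. -/
def diffSubalgebra (U : Opens (Fin 3 → ℝ)) : Subalgebra ℝ (jetDomain (U : Set (Fin 3 → ℝ)) → ℝ) where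
  carrier := {f | ∃ F, IsDiffFun (U : Set (Fin 3 → ℝ)) F ∧ ∀ z, F z.1 = f z}
  mul_mem' := by
    rintro f g ⟨F, hF, hFf⟩ ⟨G, hG, hGg⟩
    exact ⟨_, hF.comp₂ hG contDiff_mul, fun z => by simp [hFf, hGg]⟩
  add_mem' := by
    rintro f g ⟨F, hF, hFf⟩ ⟨G, hG, hGg⟩
    exact ⟨_, hF.comp₂ hG contDiff_add, fun z => by simp [hFf, hGg]⟩
  algebraMap_mem' a := ⟨_, isDiffFun_const _ a, fun _ => rfl⟩

/-- The algebra of differential functions over `U`. It is a type of its own, and not a coercion of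
`diffSubalgebra U`, so that its operations do not unfold to pointwise ones. -/
def DiffAlg (U : Opens (Fin 3 → ℝ)) : Type := diffSubalgebra U

instance (U : Opens (Fin 3 → ℝ)) : CommRing (DiffAlg U) :=
  inferInstanceAs (CommRing (diffSubalgebra U))

instance (U : Opens (Fin 3 → ℝ)) : Algebra ℝ (DiffAlg U) :=
  inferInstanceAs (Algebra ℝ (diffSubalgebra U))

variable {U : Opens (Fin 3 → ℝ)}

/-- Evaluation of a differential function at a point of the jet domain. -/
def ev (z : jetDomain (U : Set (Fin 3 → ℝ))) : DiffAlg U →ₐ[ℝ] ℝ :=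
  (Pi.evalAlgHom ℝ _ z).comp (diffSubalgebra U).val

/-- `F` is a (globally defined) function that agrees with the element `f` of the algebra of
differential functions on the jet domain. -/
def Represents (F : Jet → ℝ) (f : DiffAlg U) : Prop := ∀ z, F z.1 = ev z f

lemma exists_represents (f : DiffAlg U) :
    ∃ F, IsDiffFun (U : Set (Fin 3 → ℝ)) F ∧ Represents F f := f.2

/-- The element of the algebra given by a differential function. -/
def DiffAlg.mk (F : Jet → ℝ) (hF : IsDiffFun (U : Set (Fin 3 → ℝ)) F) : DiffAlg U :=
  ⟨fun z => F z.1, F, hF, fun _ => rfl⟩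

lemma represents_mk (F : Jet → ℝ) (hF : IsDiffFun (U : Set (Fin 3 → ℝ)) F) :
    Represents F (DiffAlg.mk F hF) := fun _ => rfl

lemma Represents.ev_eq {F : Jet → ℝ} {f : DiffAlg U} (h : Represents F f)
    (z : jetDomain (U : Set (Fin 3 → ℝ))) : ev z f = F z.1 := (h z).symm

lemma DiffAlg.ext_ev {f g : DiffAlg U} (h : ∀ z, ev z f = ev z g) : f = g :=
  Subtype.ext (funext h)

/-- The partial derivative of `f` with respect to a jet coordinate, computed on a representative. -/
def pdFun (c : Coord) (f : DiffAlg U) : DiffAlg U :=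
  DiffAlg.mk (partialD c (exists_represents f).choose)
    (isDiffFun_partialD U.isOpen (exists_represents f).choose_spec.1 c)

lemma Represents.pdFun {F : Jet → ℝ} {f : DiffAlg U} (h : Represents F f) (c : Coord) :
    Represents (partialD c F) (pdFun c f) := fun z =>
  partialD_congr U.isOpen
    (fun z hz => (h ⟨z, hz⟩).trans ((exists_represents f).choose_spec.2 ⟨z, hz⟩).symm) c z.2

lemma IsDiffFun.differentiableAt {F : Jet → ℝ} (hF : IsDiffFun (U : Set (Fin 3 → ℝ)) F) (c : Coord)
    (z : jetDomain (U : Set (Fin 3 → ℝ))) :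
    DifferentiableAt ℝ (fun t => F (Function.update z.1 c t)) (z.1 c) := by
  obtain ⟨s, hc, hs, g, hg, hFg⟩ := hF.exists_superset {c}
  exact (hasDerivAt_jet_update U.isOpen hs hg hFg (hc (by simp)) z.2).differentiableAt

/-- The partial derivatives with respect to the jet coordinates, as derivations. -/
def pd (c : Coord) : Derivation ℝ (DiffAlg U) (DiffAlg U) :=
  Derivation.mk'
    { toFun := pdFun c
      map_add' := fun f g => by
        obtain ⟨F, hF, hFf⟩ := exists_represents f
        obtain ⟨G, hG, hGg⟩ := exists_represents g
        have hFG : Represents (fun z => F z + G z) (f + g) := fun z => by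
          simp only [map_add, hFf z, hGg z]
        refine DiffAlg.ext_ev fun z => ?_
        rw [(hFG.pdFun c).ev_eq, map_add, (hFf.pdFun c).ev_eq, (hGg.pdFun c).ev_eq]
        exact deriv_add (hF.differentiableAt c z) (hG.differentiableAt c z)
      map_smul' := fun a f => by
        obtain ⟨F, hF, hFf⟩ := exists_represents f
        have haF : Represents (fun z => a * F z) (a • f) := fun z => by
          simp only [map_smul, smul_eq_mul, hFf z]
        refine DiffAlg.ext_ev fun z => ?_
        rw [(haF.pdFun c).ev_eq, RingHom.id_apply, map_smul, (hFf.pdFun c).ev_eq]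
        exact deriv_const_mul a (hF.differentiableAt c z) }
    fun f g => by
      obtain ⟨F, hF, hFf⟩ := exists_represents f
      obtain ⟨G, hG, hGg⟩ := exists_represents g
      have hFG : Represents (fun z => F z * G z) (f * g) := fun z => by
        simp only [map_mul, hFf z, hGg z]
      refine DiffAlg.ext_ev fun z => ?_
      change ev z (pdFun c (f * g)) = ev z (f • pdFun c g + g • pdFun c f)
      rw [(hFG.pdFun c).ev_eq, map_add, smul_eq_mul, smul_eq_mul, map_mul, map_mul,
        (hFf.pdFun c).ev_eq, (hGg.pdFun c).ev_eq, hFf.ev_eq, hGg.ev_eq]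
      have := deriv_mul (hF.differentiableAt c z) (hG.differentiableAt c z)
      simp only [Function.update_eq_self] at this
      rw [add_comm, mul_comm (G z.1)]
      exact this

lemma Represents.pd {F : Jet → ℝ} {f : DiffAlg U} (h : Represents F f) (c : Coord) :
    Represents (partialD c F) (pd c f) := h.pdFun c

lemma pd_comm (c d : Coord) (f : DiffAlg U) : pd c (pd d f) = pd d (pd c f) := by
  obtain ⟨F, hF, hFf⟩ := exists_represents f
  refine DiffAlg.ext_ev fun z => ?_
  rw [((hFf.pd d).pd c).ev_eq, ((hFf.pd c).pd d).ev_eq]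
  exact partialD_comm U.isOpen hF c d z.2

/-- A differential function depends on finitely many coordinates only. -/
lemma exists_pd_eq_zero (f : DiffAlg U) : ∃ s : Finset Coord, ∀ c ∉ s, pd c f = 0 := by
  obtain ⟨F, ⟨s, g, hg, hF⟩, hFf⟩ := exists_represents f
  refine ⟨s, fun c hc => DiffAlg.ext_ev fun z => ?_⟩
  rw [(hFf.pd c).ev_eq, map_zero, partialD_of_notMem hF hc]

/-- The jet coordinates as differential functions. -/
def coord (c : Coord) : DiffAlg U := DiffAlg.mk (fun z => z c) (isDiffFun_coord _ c)

lemma represents_coord (c : Coord) : Represents (fun z => z c) (coord c : DiffAlg U) :=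
  represents_mk _ (isDiffFun_coord _ c)

@[simp] lemma ev_coord (z : jetDomain (U : Set (Fin 3 → ℝ))) (c : Coord) :
    ev z (coord c) = z.1 c := rfl

@[simp] lemma pd_coord (c d : Coord) :
    pd c (coord d : DiffAlg U) = if c = d then 1 else 0 := by
  refine DiffAlg.ext_ev fun z => ?_
  rw [((represents_coord d).pd c).ev_eq]
  by_cases h : c = d
  · subst h
    simp [partialD]
  · simp [partialD, h, Function.update_of_ne (Ne.symm h)]

/-- The differential function given by a smooth function of the fields. -/
def ofFields (f : (Fin 3 → ℝ) → ℝ) (hf : ContDiffOn ℝ ∞ f U) : DiffAlg U :=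
  DiffAlg.mk (fun z => f (fields z)) (isDiffFun_comp_fields hf)

lemma represents_ofFields (f : (Fin 3 → ℝ) → ℝ) (hf : ContDiffOn ℝ ∞ f U) :
    Represents (fun z => f (fields z)) (ofFields f hf) :=
  represents_mk _ (isDiffFun_comp_fields hf)

@[simp] lemma ev_ofFields (f : (Fin 3 → ℝ) → ℝ) (hf : ContDiffOn ℝ ∞ f U)
    (z : jetDomain (U : Set (Fin 3 → ℝ))) : ev z (ofFields f hf) = f (fields z.1) := rfl

lemma ev_pd_ofFields (f : (Fin 3 → ℝ) → ℝ) (hf : ContDiffOn ℝ ∞ f U)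
    (z : jetDomain (U : Set (Fin 3 → ℝ))) (s : Fin 3) :
    ev z (pd (.jet s 0 0) (ofFields f hf)) = fderiv ℝ f (fields z.1) (Pi.single s 1) := by
  rw [((represents_ofFields f hf).pd _).ev_eq]
  have hd : HasFDerivAt f (fderiv ℝ f (fields z.1))
      (Function.update (fields z.1) s (z.1 (.jet s 0 0))) := by
    rw [show z.1 (.jet s 0 0) = fields z.1 s from rfl, Function.update_eq_self]
    exact ((hf.contDiffAt (U.isOpen.mem_nhds z.2)).differentiableAt (by simp)).hasFDerivAt
  have := hd.comp_hasDerivAt _ (hasDerivAt_update (fields z.1) s (z.1 (.jet s 0 0)))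
  refine HasDerivAt.deriv (this.congr_of_eventuallyEq (Filter.Eventually.of_forall fun t => ?_))
  simp only [Function.comp]
  congr 1
  ext i
  by_cases h : i = s
  · subst h
    simp [fields]
  · simp [fields, h]

lemma pd_ofFields_of_notMem (f : (Fin 3 → ℝ) → ℝ) (hf : ContDiffOn ℝ ∞ f U) {c : Coord}
    (hc : c ∉ fieldCoords) : pd c (ofFields f hf) = 0 := by
  refine DiffAlg.ext_ev fun z => ?_
  rw [((represents_ofFields f hf).pd c).ev_eq, map_zero]
  exact partialD_of_notMem (s := fieldCoords) (g := fun w => f fun i => w ⟨_, mem_fieldCoords i⟩)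
    (fun _ => rfl) hc z.1

/-! ### Vector fields on the jet space -/

lemma finsum_mul_pd_eq_sum (X : Coord → DiffAlg U) {f : DiffAlg U} {s : Finset Coord}
    (hs : ∀ c ∉ s, pd c f = 0) : ∑ᶠ c, X c * pd c f = ∑ c ∈ s, X c * pd c f := by
  refine finsum_eq_finsetSum_of_support_subset _ fun c hc => ?_
  by_contra h
  exact hc (by simp [hs c h])

/-- The vector field `∑ X c ∂/∂c` on the jet space, as a derivation. There is no finiteness
condition on the coefficients `X`. -/
def vf (X : Coord → DiffAlg U) : Derivation ℝ (DiffAlg U) (DiffAlg U) :=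
  Derivation.mk'
    { toFun := fun f => ∑ᶠ c, X c * pd c f
      map_add' := fun f g => by
        obtain ⟨s, hs⟩ := exists_pd_eq_zero f
        obtain ⟨t, ht⟩ := exists_pd_eq_zero g
        have hs' : ∀ c ∉ s ∪ t, pd c f = 0 := fun c hc => hs c fun h => hc (by simp [h])
        have ht' : ∀ c ∉ s ∪ t, pd c g = 0 := fun c hc => ht c fun h => hc (by simp [h])
        rw [finsum_mul_pd_eq_sum X hs', finsum_mul_pd_eq_sum X ht',
          finsum_mul_pd_eq_sum X (f := f + g) (s := s ∪ t) fun c hc => by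
            rw [map_add, hs' c hc, ht' c hc, add_zero]]
        simp only [map_add, mul_add, Finset.sum_add_distrib]
      map_smul' := fun a f => by
        obtain ⟨s, hs⟩ := exists_pd_eq_zero f
        rw [finsum_mul_pd_eq_sum X hs,
          finsum_mul_pd_eq_sum X (f := a • f) (s := s) fun c hc => by
            rw [Derivation.map_smul, hs c hc, smul_zero]]
        rw [RingHom.id_apply, Finset.smul_sum]
        exact Finset.sum_congr rfl fun c _ => by rw [Derivation.map_smul, mul_smul_comm] }
    fun f g => by
      obtain ⟨s, hs⟩ := exists_pd_eq_zero f
      obtain ⟨t, ht⟩ := exists_pd_eq_zero g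
      have hs' : ∀ c ∉ s ∪ t, pd c f = 0 := fun c hc => hs c fun h => hc (by simp [h])
      have ht' : ∀ c ∉ s ∪ t, pd c g = 0 := fun c hc => ht c fun h => hc (by simp [h])
      change ∑ᶠ c, X c * pd c (f * g) =
        f * ∑ᶠ c, X c * pd c g + g * ∑ᶠ c, X c * pd c f
      rw [finsum_mul_pd_eq_sum X hs', finsum_mul_pd_eq_sum X ht',
        finsum_mul_pd_eq_sum X (f := f * g) (s := s ∪ t) fun c hc => by
          rw [Derivation.leibniz, hs' c hc, ht' c hc, smul_zero, smul_zero, add_zero]]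
      rw [Finset.mul_sum, Finset.mul_sum, ← Finset.sum_add_distrib]
      refine Finset.sum_congr rfl fun c _ => ?_
      rw [Derivation.leibniz, smul_eq_mul, smul_eq_mul]
      ring

lemma vf_eq_sum (X : Coord → DiffAlg U) {f : DiffAlg U} {s : Finset Coord}
    (hs : ∀ c ∉ s, pd c f = 0) : vf X f = ∑ c ∈ s, X c * pd c f :=
  finsum_mul_pd_eq_sum X hs

@[simp] lemma vf_coord (X : Coord → DiffAlg U) (c : Coord) : vf X (coord c) = X c := by
  rw [vf_eq_sum X (s := {c}) fun d hd => by
    rw [pd_coord, if_neg (by simpa using hd)]]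
  simp

lemma pd_eq_vf (c : Coord) (f : DiffAlg U) : pd c f = vf (Pi.single c 1) f := by
  obtain ⟨s, hs⟩ := exists_pd_eq_zero f
  rw [vf_eq_sum _ hs]
  by_cases hc : c ∈ s
  · rw [Finset.sum_eq_single c (fun d _ hd => by simp [hd]) (fun h => absurd hc h)]
    simp
  · rw [hs c hc, Finset.sum_eq_zero fun d hd => ?_]
    have : d ≠ c := fun h => hc (h ▸ hd)
    simp [this]

/-- The commutator of two vector fields is again a vector field, with the expected coefficients.
All commutation relations between total, evolutionary and partial derivatives are instances. -/
lemma vf_comm (X Y : Coord → DiffAlg U) (f : DiffAlg U) :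
    vf X (vf Y f) - vf Y (vf X f) = vf (fun c => vf X (Y c) - vf Y (X c)) f := by
  obtain ⟨s, hs⟩ := exists_pd_eq_zero f
  have key : ∀ X Y : Coord → DiffAlg U, vf X (vf Y f) =
      ∑ c ∈ s, vf X (Y c) * pd c f + ∑ c ∈ s, ∑ d ∈ s, Y c * X d * pd d (pd c f) := by
    intro X Y
    rw [vf_eq_sum Y hs, map_sum, ← Finset.sum_add_distrib]
    refine Finset.sum_congr rfl fun c _ => ?_
    rw [Derivation.leibniz, smul_eq_mul, smul_eq_mul,
      vf_eq_sum X (f := pd c f) (s := s) fun d hd => by rw [pd_comm, hs d hd, map_zero],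
      Finset.mul_sum]
    simp only [mul_assoc]
    ring
  have hsymm : ∑ c ∈ s, ∑ d ∈ s, Y c * X d * pd d (pd c f) =
      ∑ c ∈ s, ∑ d ∈ s, X c * Y d * pd d (pd c f) := by
    rw [Finset.sum_comm]
    refine Finset.sum_congr rfl fun c _ => Finset.sum_congr rfl fun d _ => ?_
    rw [pd_comm, mul_comm (Y d)]
  rw [key X Y, key Y X, hsymm, vf_eq_sum _ hs]
  simp only [sub_mul, Finset.sum_sub_distrib]
  ring

lemma vf_congr {X Y : Coord → DiffAlg U} (h : ∀ c, X c = Y c) (f : DiffAlg U) :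
    vf X f = vf Y f := by
  rw [funext h]

@[simp] lemma vf_zero (f : DiffAlg U) : vf (fun _ => 0) f = 0 := by
  obtain ⟨s, hs⟩ := exists_pd_eq_zero f
  simp [vf_eq_sum _ hs]

lemma vf_commute {X Y : Coord → DiffAlg U} (h : ∀ c, vf X (Y c) = vf Y (X c)) (f : DiffAlg U) :
    vf X (vf Y f) = vf Y (vf X f) := by
  have := vf_comm X Y f
  rwa [vf_congr (Y := fun _ => 0) fun c => sub_eq_zero.2 (h c), vf_zero, sub_eq_zero] at this

/-! ### Total derivatives -/

/-- The coefficients of the total derivative `d/dx`. -/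
def coeffDx : Coord → DiffAlg U
  | .x => 1
  | .y => 0
  | .jet i a b => coord (.jet i (a + 1) b)

/-- The coefficients of the total derivative `d/dy`. -/
def coeffDy : Coord → DiffAlg U
  | .x => 0
  | .y => 1
  | .jet i a b => coord (.jet i a (b + 1))

/-- The total derivative `d/dx`. -/
def Dx : Derivation ℝ (DiffAlg U) (DiffAlg U) := vf coeffDx

/-- The total derivative `d/dy`. -/
def Dy : Derivation ℝ (DiffAlg U) (DiffAlg U) := vf coeffDy

@[simp] lemma Dx_jet (i : Fin 3) (a b : ℕ) :
    Dx (coord (.jet i a b) : DiffAlg U) = coord (.jet i (a + 1) b) := vf_coord _ _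
@[simp] lemma Dx_x : Dx (coord .x : DiffAlg U) = 1 := vf_coord _ _
@[simp] lemma Dx_y : Dx (coord .y : DiffAlg U) = 0 := vf_coord _ _
@[simp] lemma Dy_jet (i : Fin 3) (a b : ℕ) :
    Dy (coord (.jet i a b) : DiffAlg U) = coord (.jet i a (b + 1)) := vf_coord _ _
@[simp] lemma Dy_x : Dy (coord .x : DiffAlg U) = 0 := vf_coord _ _
@[simp] lemma Dy_y : Dy (coord .y : DiffAlg U) = 1 := vf_coord _ _

lemma Dx_Dy_comm (f : DiffAlg U) : Dx (Dy f) = Dy (Dx f) := by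
  refine vf_commute ?_ f
  rintro (_ | _ | ⟨i, a, b⟩)
  · exact (map_zero Dx).trans (Derivation.map_one_eq_zero Dy).symm
  · exact (Derivation.map_one_eq_zero Dx).trans (map_zero Dy).symm
  · exact (Dx_jet i a (b + 1)).trans (Dy_jet i (a + 1) b).symm

lemma Dx_iterate_Dy_iterate_comm (a b : ℕ) (f : DiffAlg U) :
    Dx^[a] (Dy^[b] f) = Dy^[b] (Dx^[a] f) :=
  (Function.Commute.iterate_iterate (f := (Dx : DiffAlg U → DiffAlg U))
    (g := (Dy : DiffAlg U → DiffAlg U)) Dx_Dy_comm a b) f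

lemma pd_coeffDx_zero (i : Fin 3) (b : ℕ) (c : Coord) :
    pd (.jet i 0 b) (coeffDx c : DiffAlg U) = 0 := by
  rcases c with _ | _ | ⟨j, p, q⟩ <;> simp [coeffDx]

lemma pd_coeffDx_succ (i : Fin 3) (a b : ℕ) (c : Coord) :
    pd (.jet i (a + 1) b) (coeffDx c : DiffAlg U) =
      (Pi.single (.jet i a b) 1 : Coord → DiffAlg U) c := by
  rcases c with _ | _ | ⟨j, p, q⟩
  · simp [coeffDx]
  · simp [coeffDx]
  · simp [coeffDx, Pi.single_apply, eq_comm]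

lemma pd_coeffDy_zero (i : Fin 3) (a : ℕ) (c : Coord) :
    pd (.jet i a 0) (coeffDy c : DiffAlg U) = 0 := by
  rcases c with _ | _ | ⟨j, p, q⟩ <;> simp [coeffDy]

lemma pd_coeffDy_succ (i : Fin 3) (a b : ℕ) (c : Coord) :
    pd (.jet i a (b + 1)) (coeffDy c : DiffAlg U) =
      (Pi.single (.jet i a b) 1 : Coord → DiffAlg U) c := by
  rcases c with _ | _ | ⟨j, p, q⟩
  · simp [coeffDy]
  · simp [coeffDy]
  · simp [coeffDy, Pi.single_apply, eq_comm]

/-- The commutator of a partial derivative and a vector field. -/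
lemma pd_vf (c : Coord) (X : Coord → DiffAlg U) (f : DiffAlg U) :
    pd c (vf X f) = vf X (pd c f) + vf (fun d => pd c (X d)) f := by
  have h := vf_comm (Pi.single c 1) X f
  have h0 : ∀ d, vf X ((Pi.single c 1 : Coord → DiffAlg U) d) = 0 := fun d => by
    by_cases hd : d = c
    · subst hd
      simp
    · simp [hd]
  simp only [h0, sub_zero, ← pd_eq_vf] at h
  rw [← h, add_sub_cancel]

lemma pd_zero_Dx (i : Fin 3) (b : ℕ) (f : DiffAlg U) :
    pd (.jet i 0 b) (Dx f) = Dx (pd (.jet i 0 b) f) := by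
  rw [Dx, pd_vf, vf_congr (pd_coeffDx_zero i b), vf_zero, add_zero]

lemma pd_succ_Dx (i : Fin 3) (a b : ℕ) (f : DiffAlg U) :
    pd (.jet i (a + 1) b) (Dx f) = Dx (pd (.jet i (a + 1) b) f) + pd (.jet i a b) f := by
  rw [Dx, pd_vf, vf_congr (pd_coeffDx_succ i a b), ← pd_eq_vf]

lemma pd_zero_Dy (i : Fin 3) (a : ℕ) (f : DiffAlg U) :
    pd (.jet i a 0) (Dy f) = Dy (pd (.jet i a 0) f) := by
  rw [Dy, pd_vf, vf_congr (pd_coeffDy_zero i a), vf_zero, add_zero]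

lemma pd_succ_Dy (i : Fin 3) (a b : ℕ) (f : DiffAlg U) :
    pd (.jet i a (b + 1)) (Dy f) = Dy (pd (.jet i a (b + 1)) f) + pd (.jet i a b) f := by
  rw [Dy, pd_vf, vf_congr (pd_coeffDy_succ i a b), ← pd_eq_vf]

lemma Dx_iterate_sub (a : ℕ) (f g : DiffAlg U) : Dx^[a] (f - g) = Dx^[a] f - Dx^[a] g :=
  iterate_map_sub Dx a f g

lemma Dy_iterate_sub (a : ℕ) (f g : DiffAlg U) : Dy^[a] (f - g) = Dy^[a] f - Dy^[a] g :=
  iterate_map_sub Dy a f g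

/-! ### Evolutionary vector fields -/

/-- The coefficients of the evolutionary vector field with characteristic `φ`. -/
def coeffPr (φ : Fin 3 → DiffAlg U) : Coord → DiffAlg U
  | .x => 0
  | .y => 0
  | .jet i a b => Dx^[a] (Dy^[b] (φ i))

/-- The evolutionary vector field with characteristic `φ`, that is, the derivative along
`uⁱ ↦ uⁱ + ε φⁱ`. -/
def pr (φ : Fin 3 → DiffAlg U) : Derivation ℝ (DiffAlg U) (DiffAlg U) := vf (coeffPr φ)

lemma pr_jet (φ : Fin 3 → DiffAlg U) (i : Fin 3) (a b : ℕ) :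
    pr φ (coord (.jet i a b)) = Dx^[a] (Dy^[b] (φ i)) := vf_coord _ _
@[simp] lemma pr_field (φ : Fin 3 → DiffAlg U) (i : Fin 3) :
    pr φ (coord (.jet i 0 0)) = φ i := vf_coord _ _
@[simp] lemma pr_field_y (φ : Fin 3 → DiffAlg U) (i : Fin 3) :
    pr φ (coord (.jet i 0 1)) = Dy (φ i) := vf_coord _ _

lemma pr_Dx (φ : Fin 3 → DiffAlg U) (f : DiffAlg U) : pr φ (Dx f) = Dx (pr φ f) := by
  refine vf_commute ?_ f
  rintro (_ | _ | ⟨i, a, b⟩)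
  · exact (Derivation.map_one_eq_zero (pr φ)).trans (map_zero Dx).symm
  · exact (map_zero (pr φ)).trans (map_zero Dx).symm
  · exact (pr_jet φ i (a + 1) b).trans (Function.iterate_succ_apply' _ _ _)

lemma pr_Dy (φ : Fin 3 → DiffAlg U) (f : DiffAlg U) : pr φ (Dy f) = Dy (pr φ f) := by
  refine vf_commute ?_ f
  rintro (_ | _ | ⟨i, a, b⟩)
  · exact (map_zero (pr φ)).trans (map_zero Dy).symm
  · exact (Derivation.map_one_eq_zero (pr φ)).trans (map_zero Dy).symm
  · refine (pr_jet φ i a (b + 1)).trans ?_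
    rw [Dx_iterate_Dy_iterate_comm, Function.iterate_succ_apply', ← Dx_iterate_Dy_iterate_comm a b]
    rfl

lemma pr_iterate (φ : Fin 3 → DiffAlg U) (a b : ℕ) (f : DiffAlg U) :
    pr φ (Dx^[a] (Dy^[b] f)) = Dx^[a] (Dy^[b] (pr φ f)) := by
  have hx := (Function.Commute.iterate_right (f := (pr φ : DiffAlg U → DiffAlg U))
    (g := (Dx : DiffAlg U → DiffAlg U)) (pr_Dx φ) a) (Dy^[b] f)
  have hy := (Function.Commute.iterate_right (f := (pr φ : DiffAlg U → DiffAlg U))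
    (g := (Dy : DiffAlg U → DiffAlg U)) (pr_Dy φ) b) f
  rw [hx, hy]

/-- The commutator of evolutionary vector fields is evolutionary. -/
lemma pr_comm (φ χ : Fin 3 → DiffAlg U) (f : DiffAlg U) :
    pr φ (pr χ f) - pr χ (pr φ f) = pr (fun i => pr φ (χ i) - pr χ (φ i)) f := by
  refine (vf_comm _ _ f).trans (vf_congr ?_ f)
  rintro (_ | _ | ⟨i, a, b⟩)
  · exact (congrArg₂ _ (map_zero (pr φ)) (map_zero (pr χ))).trans (sub_zero _)
  · exact (congrArg₂ _ (map_zero (pr φ)) (map_zero (pr χ))).trans (sub_zero _)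
  · change pr φ (Dx^[a] (Dy^[b] (χ i))) - pr χ (Dx^[a] (Dy^[b] (φ i))) =
      Dx^[a] (Dy^[b] (pr φ (χ i) - pr χ (φ i)))
    simp only [pr_iterate, Dy_iterate_sub, Dx_iterate_sub]

/-! ### The variational derivative -/

lemma exists_bound (f : DiffAlg U) :
    ∃ N : ℕ, ∀ i a b, N ≤ a ∨ N ≤ b → pd (.jet i a b) f = 0 := by
  obtain ⟨s, hs⟩ := exists_pd_eq_zero f
  refine ⟨(s.sup fun
    | .x => 0
    | .y => 0
    | .jet _ a b => max a b) + 1, fun i a b h => hs _ fun hc => ?_⟩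
  have := Finset.le_sup (f := fun
    | .x => 0
    | .y => 0
    | .jet _ a b => max a b) hc
  simp only at this
  omega

lemma vf_eq_box (X : Coord → DiffAlg U) {f : DiffAlg U} {N : ℕ}
    (hN : ∀ i a b, N ≤ a ∨ N ≤ b → pd (.jet i a b) f = 0) :
    vf X f = X .x * pd .x f + X .y * pd .y f +
      ∑ J ∈ (Finset.univ : Finset (Fin 3)) ×ˢ Finset.range N ×ˢ Finset.range N,
        X (.jet J.1 J.2.1 J.2.2) * pd (.jet J.1 J.2.1 J.2.2) f := by
  classical
  have hinj : Function.Injective fun J : Fin 3 × ℕ × ℕ => Coord.jet J.1 J.2.1 J.2.2 := by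
    rintro ⟨i, a, b⟩ ⟨j, c, d⟩ h
    simpa using h
  rw [vf_eq_sum X (s := insert .x (insert .y
    (((Finset.univ : Finset (Fin 3)) ×ˢ Finset.range N ×ˢ Finset.range N).image
      fun J => Coord.jet J.1 J.2.1 J.2.2))), Finset.sum_insert (by simp),
    Finset.sum_insert (by simp), Finset.sum_image hinj.injOn, add_assoc]
  rintro (_ | _ | ⟨i, a, b⟩) hc
  · simp at hc
  · simp at hc
  · refine hN i a b ?_
    by_contra! h
    exact hc (by simp [h.1, h.2])

/-- The `(a, b)` term of the variational derivative with respect to `uⁱ`. -/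
def eulerTerm (i : Fin 3) (a b : ℕ) : DiffAlg U →ₗ[ℝ] DiffAlg U :=
  (-1 : ℝ) ^ (a + b) • ((Dx : Derivation ℝ (DiffAlg U) (DiffAlg U)).toLinearMap ^ a *
    (Dy : Derivation ℝ (DiffAlg U) (DiffAlg U)).toLinearMap ^ b *
    (pd (.jet i a b) : Derivation ℝ (DiffAlg U) (DiffAlg U)).toLinearMap)

lemma eulerTerm_apply (i : Fin 3) (a b : ℕ) (f : DiffAlg U) :
    eulerTerm i a b f = (-1 : ℝ) ^ (a + b) • Dx^[a] (Dy^[b] (pd (.jet i a b) f)) := by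
  simp only [eulerTerm, LinearMap.smul_apply, Module.End.mul_apply, Module.End.pow_apply]
  rfl

lemma eulerTerm_eq_zero {i : Fin 3} {a b : ℕ} {f : DiffAlg U} (h : pd (.jet i a b) f = 0) :
    eulerTerm i a b f = 0 := by
  rw [eulerTerm_apply, h, iterate_map_zero, iterate_map_zero, smul_zero]

lemma finsum_eulerTerm {i : Fin 3} {f : DiffAlg U} {N M : ℕ}
    (hN : ∀ a b, N ≤ a ∨ M ≤ b → pd (.jet i a b) f = 0) :
    ∑ᶠ p : ℕ × ℕ, eulerTerm i p.1 p.2 f =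
      ∑ a ∈ Finset.range N, ∑ b ∈ Finset.range M, eulerTerm i a b f := by
  rw [← Finset.sum_product']
  refine finsum_eq_finsetSum_of_support_subset _ fun p hp => ?_
  by_contra h
  refine hp (eulerTerm_eq_zero (hN p.1 p.2 ?_))
  by_contra! h'
  exact h (by simp [h'.1, h'.2])

/-- The variational derivative with respect to `uⁱ`. -/
def euler (i : Fin 3) : DiffAlg U →ₗ[ℝ] DiffAlg U where
  toFun f := ∑ᶠ p : ℕ × ℕ, eulerTerm i p.1 p.2 f
  map_add' f g := by
    obtain ⟨N, hN⟩ := exists_bound f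
    obtain ⟨M, hM⟩ := exists_bound g
    have hN' : ∀ a b, max N M ≤ a ∨ max N M ≤ b → pd (.jet i a b) f = 0 :=
      fun a b h => hN i a b (by omega)
    have hM' : ∀ a b, max N M ≤ a ∨ max N M ≤ b → pd (.jet i a b) g = 0 :=
      fun a b h => hM i a b (by omega)
    rw [finsum_eulerTerm hN', finsum_eulerTerm hM',
      finsum_eulerTerm (f := f + g) (N := max N M) (M := max N M) fun a b h => by
        rw [map_add, hN' a b h, hM' a b h, add_zero]]
    simp only [map_add, Finset.sum_add_distrib]
  map_smul' r f := by
    obtain ⟨N, hN⟩ := exists_bound f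
    rw [finsum_eulerTerm (hN i), finsum_eulerTerm (f := r • f) (N := N) (M := N) fun a b h => by
      rw [Derivation.map_smul, hN i a b h, smul_zero]]
    simp only [map_smul, Finset.smul_sum, RingHom.id_apply]

lemma euler_eq_sum {i : Fin 3} {f : DiffAlg U} {N M : ℕ}
    (hN : ∀ a b, N ≤ a ∨ M ≤ b → pd (.jet i a b) f = 0) :
    euler i f = ∑ a ∈ Finset.range N, ∑ b ∈ Finset.range M, eulerTerm i a b f :=
  finsum_eulerTerm hN

lemma iterate_Dx (a b : ℕ) (f : DiffAlg U) :
    Dx^[a] (Dy^[b] (Dx f)) = Dx (Dx^[a] (Dy^[b] f)) := by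
  rw [← Function.iterate_succ_apply' Dx, Function.iterate_succ_apply Dx]
  exact congrArg _ (Dx_iterate_Dy_iterate_comm 1 b f).symm

lemma iterate_Dy (a b : ℕ) (f : DiffAlg U) :
    Dx^[a] (Dy^[b] (Dy f)) = Dy (Dx^[a] (Dy^[b] f)) := by
  rw [← Function.iterate_succ_apply Dy, Function.iterate_succ_apply' Dy]
  exact Dx_iterate_Dy_iterate_comm a 1 (Dy^[b] f)

lemma eulerTerm_succ_Dx (i : Fin 3) (a b : ℕ) (f : DiffAlg U) :
    eulerTerm i (a + 1) b (Dx f) = Dx (eulerTerm i (a + 1) b f) - Dx (eulerTerm i a b f) := by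
  simp only [eulerTerm_apply, pd_succ_Dx, Derivation.map_smul, iterate_map_add, smul_add,
    iterate_Dx]
  rw [sub_eq_add_neg, ← neg_smul, ← Function.iterate_succ_apply' Dx a]
  congr 2
  ring

lemma eulerTerm_succ_Dy (i : Fin 3) (a b : ℕ) (f : DiffAlg U) :
    eulerTerm i a (b + 1) (Dy f) = Dy (eulerTerm i a (b + 1) f) - Dy (eulerTerm i a b f) := by
  simp only [eulerTerm_apply, pd_succ_Dy, Derivation.map_smul, iterate_map_add, smul_add,
    iterate_Dy]
  rw [sub_eq_add_neg, ← neg_smul, ← iterate_Dy a b]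
  congr 2
  ring

/-- Variational derivatives vanish on total `x`-derivatives: the sum telescopes. -/
lemma euler_Dx (i : Fin 3) (f : DiffAlg U) : euler i (Dx f) = 0 := by
  obtain ⟨N, hN⟩ := exists_bound f
  have h0 : ∀ b, eulerTerm i 0 b (Dx f) = Dx (eulerTerm i 0 b f) := fun b => by
    rw [eulerTerm_apply, eulerTerm_apply, pd_zero_Dx, iterate_Dx, Derivation.map_smul]
  rw [euler_eq_sum (N := N + 1) (M := N), Finset.sum_comm]
  · refine Finset.sum_eq_zero fun b _ => ?_
    rw [Finset.sum_range_succ', h0, Finset.sum_congr rfl fun a _ => eulerTerm_succ_Dx i a b f,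
      Finset.sum_range_sub (fun a => Dx (eulerTerm i a b f)), sub_add_cancel,
      eulerTerm_eq_zero (hN i N b (Or.inl le_rfl)), map_zero]
  · rintro (_ | a) b h
    · rw [pd_zero_Dx, hN i 0 b (by omega), map_zero]
    · rw [pd_succ_Dx, hN i (a + 1) b (by omega), hN i a b (by omega), map_zero, add_zero]

lemma euler_Dy (i : Fin 3) (f : DiffAlg U) : euler i (Dy f) = 0 := by
  obtain ⟨N, hN⟩ := exists_bound f
  have h0 : ∀ a, eulerTerm i a 0 (Dy f) = Dy (eulerTerm i a 0 f) := fun a => by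
    rw [eulerTerm_apply, eulerTerm_apply, pd_zero_Dy, iterate_Dy, Derivation.map_smul]
  rw [euler_eq_sum (N := N) (M := N + 1)]
  · refine Finset.sum_eq_zero fun a _ => ?_
    rw [Finset.sum_range_succ', h0, Finset.sum_congr rfl fun b _ => eulerTerm_succ_Dy i a b f,
      Finset.sum_range_sub (fun b => Dy (eulerTerm i a b f)), sub_add_cancel,
      eulerTerm_eq_zero (hN i a N (Or.inr le_rfl)), map_zero]
  · rintro a (_ | b) h
    · rw [pd_zero_Dy, hN i a 0 (by omega), map_zero]
    · rw [pd_succ_Dy, hN i a (b + 1) (by omega), hN i a b (by omega), map_zero, add_zero]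

/-! ### Local functionals -/

/-- The space of total divergences. -/
def divergences (U : Opens (Fin 3 → ℝ)) : Submodule ℝ (DiffAlg U) :=
  LinearMap.range (Dx : Derivation ℝ (DiffAlg U) (DiffAlg U)).toLinearMap ⊔
    LinearMap.range (Dy : Derivation ℝ (DiffAlg U) (DiffAlg U)).toLinearMap

lemma mem_divergences {f : DiffAlg U} :
    f ∈ divergences U ↔ ∃ A B, f = Dx A + Dy B := by
  simp only [divergences, Submodule.mem_sup, LinearMap.mem_range]
  constructor
  · rintro ⟨_, ⟨A, rfl⟩, _, ⟨B, rfl⟩, rfl⟩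
    exact ⟨A, B, rfl⟩
  · rintro ⟨A, B, rfl⟩
    exact ⟨_, ⟨A, rfl⟩, _, ⟨B, rfl⟩, rfl⟩

/-- The local functional `∫ f dx dy`: the class of `f` modulo total divergences. -/
def functional : DiffAlg U →ₗ[ℝ] DiffAlg U ⧸ divergences U := (divergences U).mkQ

lemma functional_eq_zero {f : DiffAlg U} : functional f = 0 ↔ ∃ A B, f = Dx A + Dy B := by
  rw [← mem_divergences]
  exact Submodule.Quotient.mk_eq_zero _

@[simp] lemma functional_Dx (f : DiffAlg U) : functional (Dx f) = 0 :=
  functional_eq_zero.2 ⟨f, 0, by simp⟩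

@[simp] lemma functional_Dy (f : DiffAlg U) : functional (Dy f) = 0 :=
  functional_eq_zero.2 ⟨0, f, by simp⟩

lemma functional_Dx_mul (f g : DiffAlg U) : functional (Dx f * g) = -functional (f * Dx g) := by
  have h := functional_Dx (f * g)
  rw [Derivation.leibniz, smul_eq_mul, smul_eq_mul, map_add, mul_comm g] at h
  exact eq_neg_of_add_eq_zero_right h

lemma functional_Dy_mul (f g : DiffAlg U) : functional (Dy f * g) = -functional (f * Dy g) := by
  have h := functional_Dy (f * g)
  rw [Derivation.leibniz, smul_eq_mul, smul_eq_mul, map_add, mul_comm g] at h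
  exact eq_neg_of_add_eq_zero_right h

lemma functional_Dx_iterate_mul (a : ℕ) (f g : DiffAlg U) :
    functional (Dx^[a] f * g) = (-1 : ℝ) ^ a • functional (f * Dx^[a] g) := by
  induction a generalizing g with
  | zero => simp
  | succ a ih =>
    rw [Function.iterate_succ_apply', functional_Dx_mul, ih, Function.iterate_succ_apply, pow_succ]
    simp

lemma functional_Dy_iterate_mul (a : ℕ) (f g : DiffAlg U) :
    functional (Dy^[a] f * g) = (-1 : ℝ) ^ a • functional (f * Dy^[a] g) := by
  induction a generalizing g with
  | zero => simp
  | succ a ih =>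
    rw [Function.iterate_succ_apply', functional_Dy_mul, ih, Function.iterate_succ_apply, pow_succ]
    simp

/-- The first variation formula: integration by parts turns the derivative of a functional along
`φ` into the pairing of `φ` with the variational derivatives. -/
lemma functional_pr (φ : Fin 3 → DiffAlg U) (f : DiffAlg U) :
    functional (pr φ f) = functional (∑ i, φ i * euler i f) := by
  obtain ⟨N, hN⟩ := exists_bound f
  rw [pr, vf_eq_box _ hN, Finset.sum_product]
  simp only [coeffPr, zero_mul, zero_add, map_sum]
  refine Finset.sum_congr rfl fun i _ => ?_
  rw [euler_eq_sum (hN i), Finset.sum_product]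
  simp only [Finset.mul_sum, map_sum]
  refine Finset.sum_congr rfl fun a _ => Finset.sum_congr rfl fun b _ => ?_
  rw [functional_Dx_iterate_mul, functional_Dy_iterate_mul, eulerTerm_apply,
    ← Dx_iterate_Dy_iterate_comm, mul_smul_comm, map_smul, smul_smul, pow_add]

lemma functional_pr_congr (φ : Fin 3 → DiffAlg U) {f g : DiffAlg U}
    (h : functional f = functional g) : functional (pr φ f) = functional (pr φ g) := by
  rw [← sub_eq_zero, ← map_sub, functional_eq_zero] at h ⊢
  obtain ⟨A, B, h⟩ := h
  exact ⟨pr φ A, pr φ B, by rw [← map_sub, h, map_add, pr_Dx, pr_Dy]⟩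

/-- The second variation is symmetric. -/
lemma functional_second_variation (φ χ : Fin 3 → DiffAlg U) (f : DiffAlg U) :
    functional (∑ i, χ i * pr φ (euler i f)) = functional (∑ i, φ i * pr χ (euler i f)) := by
  have key : ∀ φ χ : Fin 3 → DiffAlg U, functional (pr φ (pr χ f)) =
      functional (∑ i, pr φ (χ i) * euler i f) + functional (∑ i, χ i * pr φ (euler i f)) := by
    intro φ χ
    rw [functional_pr_congr φ (functional_pr χ f), map_sum, ← map_add, ← Finset.sum_add_distrib]
    congr 1
    refine Finset.sum_congr rfl fun i _ => ?_
    rw [Derivation.leibniz, smul_eq_mul, smul_eq_mul]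
    ring
  have h := congrArg functional (pr_comm φ χ f)
  rw [map_sub, key φ χ, key χ φ, functional_pr] at h
  simp only [sub_mul, Finset.sum_sub_distrib, map_sub] at h
  have h' := sub_eq_zero.2 h
  rw [← sub_eq_zero, ← h']
  abel

/-! ### Comparison with the pointwise operations -/

lemma Represents.totalDx {F : Jet → ℝ} {f : DiffAlg U} (h : Represents F f) :
    Represents (totalDx F) (Dx f) := by
  intro z
  obtain ⟨N, hN⟩ := exists_bound f
  rw [Dx, vf_eq_box _ hN, Hydro.totalDx, finsum_eq_finsetSum_of_support_subset (s :=
    (Finset.univ : Finset (Fin 3)) ×ˢ Finset.range N ×ˢ Finset.range N)]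
  · simp only [coeffDx, one_mul, zero_mul, add_zero, map_add, map_sum, map_mul, ev_coord,
      (h.pd _).ev_eq]
  · rintro ⟨i, a, b⟩ hJ
    by_contra hn
    refine hJ ?_
    simp only
    rw [h.pd _ z, hN i a b, map_zero, mul_zero]
    by_contra! h'
    exact hn (by simp [h'.1, h'.2])

lemma Represents.totalDy {F : Jet → ℝ} {f : DiffAlg U} (h : Represents F f) :
    Represents (totalDy F) (Dy f) := by
  intro z
  obtain ⟨N, hN⟩ := exists_bound f
  rw [Dy, vf_eq_box _ hN, Hydro.totalDy, finsum_eq_finsetSum_of_support_subset (s :=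
    (Finset.univ : Finset (Fin 3)) ×ˢ Finset.range N ×ˢ Finset.range N)]
  · simp only [coeffDy, one_mul, zero_mul, zero_add, map_add, map_sum, map_mul, ev_coord,
      (h.pd _).ev_eq]
  · rintro ⟨i, a, b⟩ hJ
    by_contra hn
    refine hJ ?_
    simp only
    rw [h.pd _ z, hN i a b, map_zero, mul_zero]
    by_contra! h'
    exact hn (by simp [h'.1, h'.2])

lemma Represents.iterate {F : Jet → ℝ} {f : DiffAlg U} (h : Represents F f) (a b : ℕ) :
    Represents (Hydro.totalDx^[a] (Hydro.totalDy^[b] F)) (Dx^[a] (Dy^[b] f)) := by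
  induction a with
  | zero =>
    induction b with
    | zero => exact h
    | succ b ih =>
      simp only [Function.iterate_succ_apply', Function.iterate_zero, id] at ih ⊢
      exact ih.totalDy
  | succ a ih =>
    simp only [Function.iterate_succ_apply'] at ih ⊢
    exact ih.totalDx

lemma Represents.varDeriv {F : Jet → ℝ} {f : DiffAlg U} (h : Represents F f) (i : Fin 3) :
    Represents (varDeriv i F) (euler i f) := by
  intro z
  obtain ⟨N, hN⟩ := exists_bound f
  have hterm : ∀ a b, ev z (eulerTerm i a b f) = (-1 : ℝ) ^ (a + b) *
      Hydro.totalDx^[a] (Hydro.totalDy^[b] (partialD (.jet i a b) F)) z.1 := fun a b => by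
    rw [eulerTerm_apply, map_smul, smul_eq_mul, ((h.pd _).iterate a b).ev_eq]
  rw [euler_eq_sum (hN i), ← Finset.sum_product', map_sum, Hydro.varDeriv,
    finsum_eq_finsetSum_of_support_subset (s := Finset.range N ×ˢ Finset.range N)]
  · simp only [hterm]
  · rintro ⟨a, b⟩ hp
    by_contra hn
    refine hp ?_
    simp only
    rw [← hterm, eulerTerm_eq_zero (hN i a b _), map_zero]
    by_contra! h'
    exact hn (by simp [h'.1, h'.2])

lemma Represents.isTotalDivergence_iff {F : Jet → ℝ} {f : DiffAlg U} (h : Represents F f) :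
    IsTotalDivergence (U : Set (Fin 3 → ℝ)) F ↔ functional f = 0 := by
  rw [functional_eq_zero]
  constructor
  · rintro ⟨A, B, hA, hB, hF⟩
    refine ⟨DiffAlg.mk A hA, DiffAlg.mk B hB, DiffAlg.ext_ev fun z => ?_⟩
    rw [h.ev_eq, map_add, (represents_mk A hA).totalDx.ev_eq, (represents_mk B hB).totalDy.ev_eq,
      hF z.1 z.2]
  · rintro ⟨a, b, hf⟩
    obtain ⟨A, hA, hAa⟩ := exists_represents a
    obtain ⟨B, hB, hBb⟩ := exists_represents b
    refine ⟨A, B, hA, hB, fun z hz => ?_⟩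
    rw [h ⟨z, hz⟩, hf, map_add, hAa.totalDx ⟨z, hz⟩, hBb.totalDy ⟨z, hz⟩]

lemma Represents.add {F G : Jet → ℝ} {f g : DiffAlg U} (hF : Represents F f)
    (hG : Represents G g) : Represents (F + G) (f + g) := fun z => by
  rw [Pi.add_apply, hF z, hG z, map_add]

/-! ### First-order operators -/

/-- The first-order operator `g₁ d/dx + g₂ d/dy + b` with coefficients in the algebra of
differential functions. -/
def op (g₁ g₂ b : Matrix (Fin 3) (Fin 3) (DiffAlg U)) (ψ : Fin 3 → DiffAlg U) (i : Fin 3) :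
    DiffAlg U :=
  ∑ j, (g₁ i j * Dx (ψ j) + g₂ i j * Dy (ψ j) + b i j * ψ j)

/-- The variational gradient. -/
def grad (f : DiffAlg U) (i : Fin 3) : DiffAlg U := euler i f

/-- The density `∑ δf/δuⁱ P^{ij} δg/δuʲ` of the bracket of two functionals. -/
def algBracket (g₁ g₂ b : Matrix (Fin 3) (Fin 3) (DiffAlg U)) (f g : DiffAlg U) : DiffAlg U :=
  ∑ i, grad f i * op g₁ g₂ b (grad g) i

/-- `P` acts as the operator with coefficients `g₁, g₂, b` on the jet domain. -/
def RepresentsOp (P : Operator) (g₁ g₂ b : Matrix (Fin 3) (Fin 3) (DiffAlg U)) : Prop :=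
  ∀ Ψ ψ, (∀ j, Represents (Ψ j) (ψ j)) → ∀ i, Represents (P Ψ i) (op g₁ g₂ b ψ i)

lemma RepresentsOp.bracket {P : Operator} {g₁ g₂ b : Matrix (Fin 3) (Fin 3) (DiffAlg U)}
    (hP : RepresentsOp P g₁ g₂ b) {F G : Jet → ℝ} {f g : DiffAlg U} (hF : Represents F f)
    (hG : Represents G g) : Represents (bracket P F G) (algBracket g₁ g₂ b f g) := fun z => by
  rw [algBracket, map_sum, Hydro.bracket]
  refine Finset.sum_congr rfl fun i _ => ?_
  rw [map_mul, hF.varDeriv i z, hP _ _ (fun j => hG.varDeriv j) i z]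
  rfl

lemma RepresentsOp.isHamiltonian_iff {P : Operator}
    {g₁ g₂ b : Matrix (Fin 3) (Fin 3) (DiffAlg U)} (hP : RepresentsOp P g₁ g₂ b) :
    IsHamiltonian (U : Set (Fin 3 → ℝ)) P ↔
      (∀ f g, functional (algBracket g₁ g₂ b f g + algBracket g₁ g₂ b g f) = 0) ∧
      ∀ f g h, functional (algBracket g₁ g₂ b (algBracket g₁ g₂ b f g) h +
        algBracket g₁ g₂ b (algBracket g₁ g₂ b g h) f +
        algBracket g₁ g₂ b (algBracket g₁ g₂ b h f) g) = 0 := by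
  constructor
  · rintro ⟨hs, hj⟩
    refine ⟨fun f g => ?_, fun f g h => ?_⟩
    · obtain ⟨F, hF, hFf⟩ := exists_represents f
      obtain ⟨G, hG, hGg⟩ := exists_represents g
      exact ((hP.bracket hFf hGg).add (hP.bracket hGg hFf)).isTotalDivergence_iff.1 (hs F G hF hG)
    · obtain ⟨F, hF, hFf⟩ := exists_represents f
      obtain ⟨G, hG, hGg⟩ := exists_represents g
      obtain ⟨H, hH, hHh⟩ := exists_represents h
      exact (((hP.bracket (hP.bracket hFf hGg) hHh).add (hP.bracket (hP.bracket hGg hHh) hFf)).add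
        (hP.bracket (hP.bracket hHh hFf) hGg)).isTotalDivergence_iff.1 (hj F G H hF hG hH)
  · rintro ⟨hs, hj⟩
    refine ⟨fun F G hF hG => ?_, fun F G H hF hG hH => ?_⟩
    · have hFf := represents_mk F hF
      have hGg := represents_mk G hG
      exact ((hP.bracket hFf hGg).add (hP.bracket hGg hFf)).isTotalDivergence_iff.2 (hs _ _)
    · have hFf := represents_mk F hF
      have hGg := represents_mk G hG
      have hHh := represents_mk H hH
      exact (((hP.bracket (hP.bracket hFf hGg) hHh).add (hP.bracket (hP.bracket hGg hHh) hFf)).add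
        (hP.bracket (hP.bracket hHh hFf) hGg)).isTotalDivergence_iff.2 (hj _ _ _)

/-- The coefficient conditions for `g₁ d/dx + g₂ d/dy + b` to be skew-adjoint. -/
structure SkewAdjoint (g₁ g₂ b : Matrix (Fin 3) (Fin 3) (DiffAlg U)) : Prop where
  symm₁ : ∀ i j, g₁ i j = g₁ j i
  symm₂ : ∀ i j, g₂ i j = g₂ j i
  add_symm : ∀ i j, b i j + b j i = Dx (g₁ i j) + Dy (g₂ i j)

lemma SkewAdjoint.functional_op {g₁ g₂ b : Matrix (Fin 3) (Fin 3) (DiffAlg U)}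
    (hP : SkewAdjoint g₁ g₂ b) (ξ η : Fin 3 → DiffAlg U) :
    functional (∑ i, ξ i * op g₁ g₂ b η i) = -functional (∑ i, η i * op g₁ g₂ b ξ i) := by
  rw [eq_neg_iff_add_eq_zero, ← map_add, functional_eq_zero]
  refine ⟨∑ i, ∑ j, ξ i * g₁ i j * η j, ∑ i, ∑ j, ξ i * g₂ i j * η j, ?_⟩
  simp only [op, Finset.mul_sum, map_sum]
  rw [Finset.sum_comm (f := fun i j => η i * _)]
  simp only [← Finset.sum_add_distrib]
  refine Finset.sum_congr rfl fun i _ => Finset.sum_congr rfl fun j _ => ?_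
  simp only [Derivation.leibniz, smul_eq_mul]
  rw [← hP.symm₁ i j, ← hP.symm₂ i j]
  linear_combination ξ i * η j * hP.add_symm i j

/-- `∑ ξᵢ (δ_φ P)^{ij} ηⱼ`, where `δ_φ P` is the derivative along `φ` of the coefficients of
`P = g₁ d/dx + g₂ d/dy + b`. -/
def variation (g₁ g₂ b : Matrix (Fin 3) (Fin 3) (DiffAlg U)) (φ ξ η : Fin 3 → DiffAlg U) :
    DiffAlg U :=
  ∑ i, ∑ j, ξ i * (pr φ (g₁ i j) * Dx (η j) + pr φ (g₂ i j) * Dy (η j) + pr φ (b i j) * η j)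

/-- The Schouten bracket `[P, P]`, evaluated on three covectors. -/
def trivector (g₁ g₂ b : Matrix (Fin 3) (Fin 3) (DiffAlg U)) (ξ η ζ : Fin 3 → DiffAlg U) :
    DiffAlg U :=
  variation g₁ g₂ b (op g₁ g₂ b ζ) ξ η + variation g₁ g₂ b (op g₁ g₂ b ξ) η ζ +
    variation g₁ g₂ b (op g₁ g₂ b η) ζ ξ

lemma pr_sum_mul_op (g₁ g₂ b : Matrix (Fin 3) (Fin 3) (DiffAlg U)) (φ ξ η : Fin 3 → DiffAlg U) :
    pr φ (∑ i, ξ i * op g₁ g₂ b η i) =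
      ∑ i, op g₁ g₂ b η i * pr φ (ξ i) + variation g₁ g₂ b φ ξ η +
        ∑ i, ξ i * op g₁ g₂ b (fun j => pr φ (η j)) i := by
  simp only [map_sum, variation, Derivation.leibniz, smul_eq_mul, ← Finset.sum_add_distrib]
  refine Finset.sum_congr rfl fun i _ => ?_
  have : pr φ (op g₁ g₂ b η i) = ∑ j, (pr φ (g₁ i j) * Dx (η j) + pr φ (g₂ i j) * Dy (η j) +
      pr φ (b i j) * η j) + op g₁ g₂ b (fun j => pr φ (η j)) i := by
    simp only [op, map_sum, map_add, Derivation.leibniz, smul_eq_mul, ← Finset.sum_add_distrib,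
      pr_Dx, pr_Dy]
    exact Finset.sum_congr rfl fun j _ => by ring
  rw [this, mul_add, Finset.mul_sum]
  ring

/-- For a skew-adjoint operator, the cyclic sum of iterated brackets is the Schouten bracket
evaluated on the variational gradients. The terms in which the gradients are differentiated cancel,
because second variations are symmetric. -/
lemma SkewAdjoint.functional_jacobi {g₁ g₂ b : Matrix (Fin 3) (Fin 3) (DiffAlg U)}
    (hP : SkewAdjoint g₁ g₂ b) (f g h : DiffAlg U) :
    functional (algBracket g₁ g₂ b (algBracket g₁ g₂ b f g) h +
        algBracket g₁ g₂ b (algBracket g₁ g₂ b g h) f +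
        algBracket g₁ g₂ b (algBracket g₁ g₂ b h f) g) =
      functional (trivector g₁ g₂ b (grad f) (grad g) (grad h)) := by
  have key : ∀ f g h : DiffAlg U,
      functional (algBracket g₁ g₂ b (algBracket g₁ g₂ b f g) h) =
        functional (∑ i, op g₁ g₂ b (grad g) i * pr (op g₁ g₂ b (grad h)) (euler i f)) +
        functional (variation g₁ g₂ b (op g₁ g₂ b (grad h)) (grad f) (grad g)) -
        functional (∑ i, op g₁ g₂ b (grad f) i * pr (op g₁ g₂ b (grad h)) (euler i g)) := by
    intro f g h
    have h1 : algBracket g₁ g₂ b (algBracket g₁ g₂ b f g) h =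
        ∑ i, op g₁ g₂ b (grad h) i * euler i (algBracket g₁ g₂ b f g) :=
      Finset.sum_congr rfl fun i _ => mul_comm _ _
    rw [h1, ← functional_pr, algBracket, pr_sum_mul_op, map_add, map_add, hP.functional_op (grad f),
      ← sub_eq_add_neg]
    congr 2
    exact Finset.sum_congr rfl fun i _ => mul_comm _ _
  simp only [map_add, key, trivector]
  rw [functional_second_variation (op g₁ g₂ b (grad h)) (op g₁ g₂ b (grad g)) f,
    functional_second_variation (op g₁ g₂ b (grad f)) (op g₁ g₂ b (grad h)) g,
    functional_second_variation (op g₁ g₂ b (grad g)) (op g₁ g₂ b (grad f)) h]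
  abel

lemma RepresentsOp.isHamiltonian_iff_trivector {P : Operator}
    {g₁ g₂ b : Matrix (Fin 3) (Fin 3) (DiffAlg U)} (hP : RepresentsOp P g₁ g₂ b)
    (hs : SkewAdjoint g₁ g₂ b) :
    IsHamiltonian (U : Set (Fin 3 → ℝ)) P ↔
      ∀ f g h, functional (trivector g₁ g₂ b (grad f) (grad g) (grad h)) = 0 := by
  simp only [hP.isHamiltonian_iff, hs.functional_jacobi]
  refine and_iff_right fun f g => ?_
  rw [map_add, algBracket, hs.functional_op, neg_add_eq_zero]
  rfl

/-! ### Variational derivatives at constant states -/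

/-- The jet at the origin of the constant fields `(u, v, w) = q`. -/
def constJet (q : Fin 3 → ℝ) : Jet
  | .jet i 0 0 => q i
  | _ => 0

/-- The jet of constant fields with values in `U`, as a point of the jet domain. -/
def constPt {q : Fin 3 → ℝ} (hq : q ∈ U) : jetDomain (U : Set (Fin 3 → ℝ)) := ⟨constJet q, hq⟩

@[simp] lemma constPt_field {q : Fin 3 → ℝ} (hq : q ∈ U) (i : Fin 3) :
    (constPt hq).1 (.jet i 0 0) = q i := rfl
@[simp] lemma constPt_succ_left {q : Fin 3 → ℝ} (hq : q ∈ U) (i : Fin 3) (a b : ℕ) :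
    (constPt hq).1 (.jet i (a + 1) b) = 0 := rfl
@[simp] lemma constPt_succ_right {q : Fin 3 → ℝ} (hq : q ∈ U) (i : Fin 3) (a b : ℕ) :
    (constPt hq).1 (.jet i a (b + 1)) = 0 := by cases a <;> rfl
@[simp] lemma constPt_x {q : Fin 3 → ℝ} (hq : q ∈ U) : (constPt hq).1 .x = 0 := rfl
@[simp] lemma constPt_y {q : Fin 3 → ℝ} (hq : q ∈ U) : (constPt hq).1 .y = 0 := rfl
@[simp] lemma fields_constPt {q : Fin 3 → ℝ} (hq : q ∈ U) : fields (constPt hq).1 = q := rfl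

lemma ev_constPt_Dx {q : Fin 3 → ℝ} (hq : q ∈ U) (f : DiffAlg U) :
    ev (constPt hq) (Dx f) = ev (constPt hq) (pd .x f) := by
  obtain ⟨N, hN⟩ := exists_bound f
  rw [Dx, vf_eq_box _ hN]
  simp [coeffDx]

lemma ev_constPt_Dy {q : Fin 3 → ℝ} (hq : q ∈ U) (f : DiffAlg U) :
    ev (constPt hq) (Dy f) = ev (constPt hq) (pd .y f) := by
  obtain ⟨N, hN⟩ := exists_bound f
  rw [Dy, vf_eq_box _ hN]
  simp [coeffDy]

lemma pd_x_Dx (f : DiffAlg U) : pd .x (Dx f) = Dx (pd .x f) := by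
  rw [Dx, pd_vf, vf_congr (X := fun d => pd .x (coeffDx d)) (Y := fun _ => 0), vf_zero, add_zero]
  rintro (_ | _ | ⟨j, p, q⟩) <;> simp [coeffDx]

lemma pd_x_Dy (f : DiffAlg U) : pd .x (Dy f) = Dy (pd .x f) := by
  rw [Dy, pd_vf, vf_congr (X := fun d => pd .x (coeffDy d)) (Y := fun _ => 0), vf_zero, add_zero]
  rintro (_ | _ | ⟨j, p, q⟩) <;> simp [coeffDy]

lemma pd_y_Dy (f : DiffAlg U) : pd .y (Dy f) = Dy (pd .y f) := by
  rw [Dy, pd_vf, vf_congr (X := fun d => pd .y (coeffDy d)) (Y := fun _ => 0), vf_zero, add_zero]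
  rintro (_ | _ | ⟨j, p, q⟩) <;> simp [coeffDy]

lemma pd_x_iterate (a b : ℕ) (f : DiffAlg U) :
    pd .x (Dx^[a] (Dy^[b] f)) = Dx^[a] (Dy^[b] (pd .x f)) := by
  have hx := (Function.Commute.iterate_right (f := (pd .x : DiffAlg U → DiffAlg U))
    (g := (Dx : DiffAlg U → DiffAlg U)) pd_x_Dx a) (Dy^[b] f)
  have hy := (Function.Commute.iterate_right (f := (pd .x : DiffAlg U → DiffAlg U))
    (g := (Dy : DiffAlg U → DiffAlg U)) pd_x_Dy b) f
  rw [hx, hy]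

lemma pd_y_iterate (b : ℕ) (f : DiffAlg U) : pd .y (Dy^[b] f) = Dy^[b] (pd .y f) :=
  (Function.Commute.iterate_right (f := (pd .y : DiffAlg U → DiffAlg U))
    (g := (Dy : DiffAlg U → DiffAlg U)) pd_y_Dy b) f

/-- The differential function `uⁱ - qᵢ`, which vanishes with all its total derivatives at the
constant state `q`. -/
def shift (i : Fin 3) (q : Fin 3 → ℝ) : DiffAlg U :=
  coord (.jet i 0 0) - algebraMap ℝ (DiffAlg U) (q i)

lemma ev_iterate_shift_mul {q : Fin 3 → ℝ} (hq : q ∈ U) (i : Fin 3) (a b : ℕ) (f : DiffAlg U) :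
    ev (constPt hq) (Dx^[a] (Dy^[b] (shift i q * f))) = 0 := by
  induction a generalizing f with
  | zero =>
    induction b generalizing f with
    | zero => simp [shift]
    | succ b ih =>
      simp only [Function.iterate_zero, id] at ih ⊢
      rw [Function.iterate_succ_apply', ev_constPt_Dy, pd_y_iterate, Derivation.leibniz]
      simpa [shift] using ih (pd .y f)
  | succ a ih =>
    rw [Function.iterate_succ_apply', ev_constPt_Dx, pd_x_iterate, Derivation.leibniz]
    simpa [shift] using ih (pd .x f)

/-- The variational derivative of `(uⁱ - qᵢ) f` at the constant state `q` is the value of `f`. -/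
lemma ev_euler_shift_mul {q : Fin 3 → ℝ} (hq : q ∈ U) (i : Fin 3) (f : DiffAlg U) :
    ev (constPt hq) (euler i (shift i q * f)) = ev (constPt hq) f := by
  obtain ⟨N, hN⟩ := exists_bound (shift i q * f)
  have hterm : ∀ a b, ev (constPt hq) (eulerTerm i a b (shift i q * f)) =
      if a = 0 ∧ b = 0 then ev (constPt hq) f else 0 := by
    intro a b
    have hpd : pd (.jet i a b) (shift i q : DiffAlg U) = if a = 0 ∧ b = 0 then 1 else 0 := by
      simp [shift]
    rw [eulerTerm_apply, Derivation.leibniz, hpd, smul_eq_mul, smul_eq_mul, iterate_map_add,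
      iterate_map_add, map_smul, map_add, ev_iterate_shift_mul, zero_add]
    split_ifs with h
    · simp [h.1, h.2]
    · simp [iterate_map_zero]
  rw [euler_eq_sum (N := N + 1) (M := N + 1) fun a b h => hN i a b (by omega)]
  simp only [map_sum, hterm]
  rw [Finset.sum_eq_single 0, Finset.sum_eq_single 0] <;> simp +contextual

/-- Evaluation at the constant state `q` of the variational derivative with respect to `uⁱ`. -/
def testAt {q : Fin 3 → ℝ} (hq : q ∈ U) (i : Fin 3) : DiffAlg U →ₗ[ℝ] ℝ :=
  (ev (constPt hq)).toLinearMap ∘ₗ euler i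

lemma testAt_shift_mul {q : Fin 3 → ℝ} (hq : q ∈ U) (i : Fin 3) (f : DiffAlg U) :
    testAt hq i (shift i q * f) = ev (constPt hq) f := ev_euler_shift_mul hq i f

lemma testAt_of_functional_eq_zero {q : Fin 3 → ℝ} (hq : q ∈ U) (i : Fin 3) {f : DiffAlg U}
    (hf : functional f = 0) : testAt hq i f = 0 := by
  obtain ⟨A, B, rfl⟩ := functional_eq_zero.1 hf
  simp [testAt, euler_Dx, euler_Dy]

lemma testAt_Dx_mul {q : Fin 3 → ℝ} (hq : q ∈ U) (i : Fin 3) (f g : DiffAlg U) :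
    testAt hq i (Dx f * g) = -testAt hq i (f * Dx g) := by
  have h := testAt_of_functional_eq_zero hq i (functional_Dx (f * g))
  rw [Derivation.leibniz, smul_eq_mul, smul_eq_mul, map_add, mul_comm g] at h
  exact eq_neg_of_add_eq_zero_right h

lemma testAt_Dy_mul {q : Fin 3 → ℝ} (hq : q ∈ U) (i : Fin 3) (f g : DiffAlg U) :
    testAt hq i (Dy f * g) = -testAt hq i (f * Dy g) := by
  have h := testAt_of_functional_eq_zero hq i (functional_Dy (f * g))
  rw [Derivation.leibniz, smul_eq_mul, smul_eq_mul, map_add, mul_comm g] at h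
  exact eq_neg_of_add_eq_zero_right h

/-! ### Test functionals -/

lemma euler_of_order_zero {s : Fin 3} {f : DiffAlg U}
    (h : ∀ a b, 1 ≤ a ∨ 1 ≤ b → pd (.jet s a b) f = 0) : euler s f = pd (.jet s 0 0) f := by
  rw [euler_eq_sum (N := 1) (M := 1) h]
  simp [eulerTerm_apply]

lemma grad_mul_coord (r : DiffAlg U) (hr : ∀ s a b, pd (.jet s a b) r = 0) (k : Fin 3) :
    grad (r * coord (.jet k 0 0)) = Pi.single k r := by
  funext s
  have h : ∀ a b, pd (.jet s a b) (r * coord (.jet k 0 0)) =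
      if s = k ∧ a = 0 ∧ b = 0 then r else 0 := fun a b => by
    rw [Derivation.leibniz, hr]
    simp
  rw [grad, euler_of_order_zero fun a b hab => by rw [h, if_neg (by omega)], h]
  simp [Pi.single_apply]

lemma grad_coord (k : Fin 3) : grad (coord (.jet k 0 0) : DiffAlg U) = Pi.single k 1 := by
  simpa using grad_mul_coord (1 : DiffAlg U) (by simp) k

lemma grad_shift_sq (i : Fin 3) (q : Fin 3 → ℝ) :
    grad ((1 / 2 : ℝ) • (shift i q * shift i q) : DiffAlg U) = Pi.single i (shift i q) := by
  funext s
  have h : ∀ a b, pd (.jet s a b) ((1 / 2 : ℝ) • (shift i q * shift i q) : DiffAlg U) =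
      if s = i ∧ a = 0 ∧ b = 0 then shift i q else 0 := fun a b => by
    have h1 : pd (.jet s a b) (shift i q : DiffAlg U) =
        if s = i ∧ a = 0 ∧ b = 0 then 1 else 0 := by simp [shift]
    rw [Derivation.map_smul, Derivation.leibniz, h1, smul_eq_mul]
    split_ifs
    · rw [mul_one, ← two_smul ℝ, smul_smul]
      norm_num
    · simp
  rw [grad, euler_of_order_zero fun a b hab => by rw [h, if_neg (by omega)], h]
  simp [Pi.single_apply]

lemma op_single (g₁ g₂ b : Matrix (Fin 3) (Fin 3) (DiffAlg U)) (k : Fin 3) (r : DiffAlg U)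
    (s : Fin 3) :
    op g₁ g₂ b (Pi.single k r) s = g₁ s k * Dx r + g₂ s k * Dy r + b s k * r := by
  rw [op, Finset.sum_eq_single k]
  · simp
  · intro j _ hj
    simp [hj]
  · simp

lemma variation_single (g₁ g₂ b : Matrix (Fin 3) (Fin 3) (DiffAlg U)) (φ : Fin 3 → DiffAlg U)
    (i j : Fin 3) (f g : DiffAlg U) :
    variation g₁ g₂ b φ (Pi.single i f) (Pi.single j g) =
      f * (pr φ (g₁ i j) * Dx g + pr φ (g₂ i j) * Dy g + pr φ (b i j) * g) := by
  rw [variation, Finset.sum_eq_single i, Finset.sum_eq_single j]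
  · simp
  · intro j _ hj
    simp [hj]
  · simp
  · intro j _ hj
    simp [hj]
  · simp

/-- Coefficients `g₁, g₂, b` that are, respectively, constant, functions of the fields, and
functions of the fields and their `y`-derivatives. -/
structure Autonomous (g₁ g₂ b : Matrix (Fin 3) (Fin 3) (DiffAlg U)) : Prop where
  pd₁ : ∀ c i j, pd c (g₁ i j) = 0
  pd₂ : ∀ c i j, (∀ s, c ≠ .jet s 0 0) → pd c (g₂ i j) = 0
  pd₀ : ∀ c i j, (∀ s, c ≠ .jet s 0 0 ∧ c ≠ .jet s 0 1) → pd c (b i j) = 0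

lemma vf_of_order_one (X : Coord → DiffAlg U) {f : DiffAlg U}
    (h : ∀ c, (∀ s, c ≠ .jet s 0 0 ∧ c ≠ .jet s 0 1) → pd c f = 0) :
    vf X f = ∑ s, (X (.jet s 0 0) * pd (.jet s 0 0) f + X (.jet s 0 1) * pd (.jet s 0 1) f) := by
  rw [vf_eq_box X (N := 2) fun i a b hab => h _ fun s => by
    constructor <;> · simp only [ne_eq, Coord.jet.injEq]; omega]
  rw [h .x (by simp), h .y (by simp), Finset.sum_product]
  simp only [mul_zero, zero_add]
  refine Finset.sum_congr rfl fun s _ => ?_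
  rw [Finset.sum_product]
  simp only [Finset.sum_range_succ, Finset.range_zero, Finset.sum_empty, zero_add]
  rw [h (.jet s 1 0) (by simp), h (.jet s 1 1) (by simp)]
  ring

lemma Autonomous.pr_g₁ {g₁ g₂ b : Matrix (Fin 3) (Fin 3) (DiffAlg U)} (h : Autonomous g₁ g₂ b)
    (φ : Fin 3 → DiffAlg U) (i j : Fin 3) : pr φ (g₁ i j) = 0 := by
  rw [pr, vf_of_order_one _ fun c _ => h.pd₁ c i j]
  simp [h.pd₁]

lemma Autonomous.pr_g₂ {g₁ g₂ b : Matrix (Fin 3) (Fin 3) (DiffAlg U)} (h : Autonomous g₁ g₂ b)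
    (φ : Fin 3 → DiffAlg U) (i j : Fin 3) :
    pr φ (g₂ i j) = ∑ s, φ s * pd (.jet s 0 0) (g₂ i j) := by
  rw [pr, vf_of_order_one _ fun c hc => h.pd₂ c i j fun s => (hc s).1]
  simp [h.pd₂ (.jet _ 0 1) i j (by simp), coeffPr]

lemma Autonomous.pr_b {g₁ g₂ b : Matrix (Fin 3) (Fin 3) (DiffAlg U)} (h : Autonomous g₁ g₂ b)
    (φ : Fin 3 → DiffAlg U) (i j : Fin 3) :
    pr φ (b i j) =
      ∑ s, (φ s * pd (.jet s 0 0) (b i j) + Dy (φ s) * pd (.jet s 0 1) (b i j)) := by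
  rw [pr, vf_of_order_one _ fun c hc => h.pd₀ c i j hc]
  simp [coeffPr]

lemma testAt_op_shift_mul {g₁ g₂ b : Matrix (Fin 3) (Fin 3) (DiffAlg U)}
    (h : Autonomous g₁ g₂ b) {q : Fin 3 → ℝ} (hq : q ∈ U) (i s : Fin 3) (f : DiffAlg U) :
    testAt hq i (op g₁ g₂ b (Pi.single i (shift i q)) s * f) =
      ev (constPt hq) (b s i * f) - ev (constPt hq) (g₁ s i * pd .x f) -
        ev (constPt hq) (g₂ s i * pd .y f) := by
  have h1 : testAt hq i (Dx (shift i q) * (g₁ s i * f)) =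
      -ev (constPt hq) (g₁ s i * pd .x f) := by
    rw [testAt_Dx_mul, testAt_shift_mul, ev_constPt_Dx, Derivation.leibniz, h.pd₁]
    simp
  have h2 : testAt hq i (Dy (shift i q) * (g₂ s i * f)) =
      -ev (constPt hq) (g₂ s i * pd .y f) := by
    rw [testAt_Dy_mul, testAt_shift_mul, ev_constPt_Dy, Derivation.leibniz,
      h.pd₂ _ _ _ (by simp)]
    simp
  have h3 := testAt_shift_mul hq i (b s i * f)
  have : op g₁ g₂ b (Pi.single i (shift i q)) s * f = Dx (shift i q) * (g₁ s i * f) +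
      Dy (shift i q) * (g₂ s i * f) + shift i q * (b s i * f) := by
    rw [op_single]
    ring
  rw [this, map_add, map_add, h1, h2, h3]
  ring

/-- The compatibility conditions on the coefficients of a Hamiltonian operator: the density
`[P, P](δF, δG, δH)`, with `F = ½ ∫ (uⁱ - qᵢ)²`, `G = ∫ uʲ` and `H = ∫ (a x + e y) uᵏ`, has zero
variational derivative with respect to `uⁱ` at the constant state `q`. -/
lemma Autonomous.compatibility {g₁ g₂ b : Matrix (Fin 3) (Fin 3) (DiffAlg U)}
    (h : Autonomous g₁ g₂ b)
    (hT : ∀ f g h, functional (trivector g₁ g₂ b (grad f) (grad g) (grad h)) = 0)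
    {q : Fin 3 → ℝ} (hq : q ∈ U) (i j k : Fin 3) (a e : ℝ) :
    ∑ s, (ev (constPt hq) (pd (.jet s 0 0) (b i j)) *
          (a * ev (constPt hq) (g₁ s k) + e * ev (constPt hq) (g₂ s k)) +
        e * ev (constPt hq) (pd (.jet s 0 1) (b i j)) * ev (constPt hq) (b s k) +
        e * ev (constPt hq) (pd (.jet s 0 0) (g₂ j k)) * ev (constPt hq) (b s i)) =
    ∑ s, (ev (constPt hq) (pd (.jet s 0 0) (b j k)) *
          (a * ev (constPt hq) (g₁ s i) + e * ev (constPt hq) (g₂ s i)) +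
        e * ev (constPt hq) (pd (.jet s 0 1) (b j k)) * ev (constPt hq) (b s i) +
        e * ev (constPt hq) (pd (.jet s 0 0) (g₂ k i)) * ev (constPt hq) (b s j)) := by
  -- `H` has the density `r uᵏ`; at the origin `r` vanishes, and its derivatives are `a` and `e`
  obtain ⟨r, hr⟩ : ∃ r : DiffAlg U, r = a • coord .x + e • coord .y := ⟨_, rfl⟩
  have hr0 : ev (constPt hq) r = 0 := by simp [hr]
  have hrx : Dx r = algebraMap ℝ _ a := by simp [hr, Algebra.algebraMap_eq_smul_one]
  have hry : Dy r = algebraMap ℝ _ e := by simp [hr, Algebra.algebraMap_eq_smul_one]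
  have hrpx : pd .x r = algebraMap ℝ _ a := by simp [hr, Algebra.algebraMap_eq_smul_one]
  have hrpy : pd .y r = algebraMap ℝ _ e := by simp [hr, Algebra.algebraMap_eq_smul_one]
  have hrj : ∀ s m n, pd (.jet s m n) r = 0 := by simp [hr]
  have hbx : ∀ s k, pd .x (b s k) = 0 := fun s k => h.pd₀ _ _ _ (by simp)
  have hby : ∀ s k, pd .y (b s k) = 0 := fun s k => h.pd₀ _ _ _ (by simp)
  have hgx : ∀ s k, pd .x (g₂ s k) = 0 := fun s k => h.pd₂ _ _ _ (by simp)
  have hgy : ∀ s k, pd .y (g₂ s k) = 0 := fun s k => h.pd₂ _ _ _ (by simp)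
  have hT' := testAt_of_functional_eq_zero hq i (hT ((1 / 2 : ℝ) • (shift i q * shift i q))
    (coord (.jet j 0 0)) (r * coord (.jet k 0 0)))
  rw [grad_shift_sq, grad_coord, grad_mul_coord r hrj, trivector, map_add, map_add,
    variation_single, variation_single, variation_single] at hT'
  -- The three terms of the Schouten bracket; in the second, derivatives of `uⁱ - qᵢ` are
  -- integrated by parts.
  have e1 : testAt hq i (shift i q * (pr (op g₁ g₂ b (Pi.single k r)) (g₁ i j) * Dx 1 +
        pr (op g₁ g₂ b (Pi.single k r)) (g₂ i j) * Dy 1 +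
        pr (op g₁ g₂ b (Pi.single k r)) (b i j) * 1)) =
      ∑ s, (ev (constPt hq) (pd (.jet s 0 0) (b i j)) *
          (a * ev (constPt hq) (g₁ s k) + e * ev (constPt hq) (g₂ s k)) +
        e * ev (constPt hq) (pd (.jet s 0 1) (b i j)) * ev (constPt hq) (b s k)) := by
    rw [testAt_shift_mul, h.pr_b]
    simp only [Derivation.map_one_eq_zero, mul_zero, zero_add, mul_one, map_sum]
    refine Finset.sum_congr rfl fun s _ => ?_
    rw [map_add, map_mul, map_mul, ev_constPt_Dy, op_single, hrx, hry]
    simp only [map_add, map_mul, Derivation.leibniz, hrpy, hby, hgy, h.pd₁, hr0, smul_eq_mul,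
      Derivation.map_algebraMap, AlgHom.commutes, mul_zero, add_zero, zero_add]
    simp
    ring
  have e2 : testAt hq i (1 * (pr (op g₁ g₂ b (Pi.single i (shift i q))) (g₁ j k) * Dx r +
        pr (op g₁ g₂ b (Pi.single i (shift i q))) (g₂ j k) * Dy r +
        pr (op g₁ g₂ b (Pi.single i (shift i q))) (b j k) * r)) =
      ∑ s, (e * ev (constPt hq) (pd (.jet s 0 0) (g₂ j k)) * ev (constPt hq) (b s i)) -
      ∑ s, (ev (constPt hq) (pd (.jet s 0 0) (b j k)) *
          (a * ev (constPt hq) (g₁ s i) + e * ev (constPt hq) (g₂ s i)) +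
        e * ev (constPt hq) (pd (.jet s 0 1) (b j k)) * ev (constPt hq) (b s i)) := by
    rw [h.pr_g₁, h.pr_g₂, h.pr_b, hry, one_mul, zero_mul, zero_add, Finset.sum_mul, Finset.sum_mul,
      map_add, map_sum, map_sum, ← Finset.sum_add_distrib, ← Finset.sum_sub_distrib]
    refine Finset.sum_congr rfl fun s _ => ?_
    rw [add_mul, mul_assoc, mul_assoc, mul_assoc, map_add, testAt_Dy_mul, testAt_op_shift_mul h,
      testAt_op_shift_mul h, testAt_op_shift_mul h, pd_x_Dy, pd_y_Dy, map_mul _ _ (Dy _),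
      map_mul _ _ (Dy _), map_mul _ _ (Dy _), ev_constPt_Dy, ev_constPt_Dy, ev_constPt_Dy]
    simp only [map_mul, Derivation.leibniz, hrpx, hrpy, hr0, smul_eq_mul, pd_comm .x,
      pd_comm .y, hbx, hby, hgx, hgy, map_zero, Derivation.map_algebraMap, AlgHom.commutes,
      mul_zero, add_zero]
    simp
    ring
  have e3 : testAt hq i (r * (pr (op g₁ g₂ b (Pi.single j 1)) (g₁ k i) * Dx (shift i q) +
        pr (op g₁ g₂ b (Pi.single j 1)) (g₂ k i) * Dy (shift i q) +
        pr (op g₁ g₂ b (Pi.single j 1)) (b k i) * shift i q)) =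
      -∑ s, (e * ev (constPt hq) (pd (.jet s 0 0) (g₂ k i)) * ev (constPt hq) (b s j)) := by
    have : r * (pr (op g₁ g₂ b (Pi.single j 1)) (g₁ k i) * Dx (shift i q) +
        pr (op g₁ g₂ b (Pi.single j 1)) (g₂ k i) * Dy (shift i q) +
        pr (op g₁ g₂ b (Pi.single j 1)) (b k i) * shift i q) =
        Dy (shift i q) * (r * pr (op g₁ g₂ b (Pi.single j 1)) (g₂ k i)) +
        shift i q * (r * pr (op g₁ g₂ b (Pi.single j 1)) (b k i)) := by
      rw [h.pr_g₁]
      ring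
    rw [this, map_add, testAt_shift_mul, testAt_Dy_mul, testAt_shift_mul, ev_constPt_Dy,
      Derivation.leibniz, hrpy, h.pr_g₂]
    simp only [smul_eq_mul, map_add, map_mul, hr0, zero_mul, zero_add, add_zero, AlgHom.commutes,
      map_sum, Finset.sum_mul, op_single, Derivation.map_one_eq_zero, mul_zero, mul_one]
    congr 1
    refine Finset.sum_congr rfl fun s _ => ?_
    simp
    ring
  rw [e1, e2, e3] at hT'
  simp only [Finset.sum_add_distrib] at hT' ⊢
  linarith

/-! ### The operators `P₃ + ω` and `P₄ + ω` -/

/-- The field `uⁱ`, as a differential function. -/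
abbrev fld (i : Fin 3) : DiffAlg U := coord (.jet i 0 0)

/-- The derivative `∂_y uⁱ`. -/
abbrev fldy (i : Fin 3) : DiffAlg U := coord (.jet i 0 1)

/-- The coefficient of `d/dx` in `P₃` and `P₄`. -/
def gX : Matrix (Fin 3) (Fin 3) (DiffAlg U) := !![0, 0, 1; 0, 1, 0; 1, 0, 0]

/-- The coefficient of `d/dy` in `P₃`. -/
def g₃ (lam : ℝ) : Matrix (Fin 3) (Fin 3) (DiffAlg U) :=
  !![(-2 : ℝ) • fld 1, fld 2, algebraMap ℝ _ lam;
    fld 2, algebraMap ℝ _ lam, 0;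
    algebraMap ℝ _ lam, 0, 0]

/-- The coefficient of `d/dy` in `P₄`. -/
def g₄ : Matrix (Fin 3) (Fin 3) (DiffAlg U) :=
  !![(-2 : ℝ) • fld 0, (-(1 / 2) : ℝ) • fld 1, fld 2;
    (-(1 / 2) : ℝ) • fld 1, fld 2, 0;
    fld 2, 0, 0]

/-- The term of order zero in `P₃ + ω`. -/
def b₃ (F₁ F₂ F₃ : DiffAlg U) : Matrix (Fin 3) (Fin 3) (DiffAlg U) :=
  !![-fldy 1, (2 : ℝ) • fldy 2 + F₁, F₂;
    -fldy 2 - F₁, 0, F₃;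
    -F₂, -F₃, 0]

/-- The term of order zero in `P₄ + ω`. -/
def b₄ (F₁ F₂ F₃ : DiffAlg U) : Matrix (Fin 3) (Fin 3) (DiffAlg U) :=
  !![-fldy 0, (1 / 2 : ℝ) • fldy 1 + F₁, (2 : ℝ) • fldy 2 + F₂;
    -fldy 1 - F₁, (1 / 2 : ℝ) • fldy 2, F₃;
    -fldy 2 - F₂, -F₃, 0]

lemma representsOp_P₃ (lam : ℝ) {f₁ f₂ f₃ : (Fin 3 → ℝ) → ℝ} (hf₁ : ContDiffOn ℝ ∞ f₁ U)
    (hf₂ : ContDiffOn ℝ ∞ f₂ U) (hf₃ : ContDiffOn ℝ ∞ f₃ U) :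
    RepresentsOp (P₃ lam + ultralocal f₁ f₂ f₃) (gX : Matrix _ _ (DiffAlg U)) (g₃ lam)
      (b₃ (ofFields f₁ hf₁) (ofFields f₂ hf₂) (ofFields f₃ hf₃)) := by
  intro Ψ ψ h i z
  have h0 : ∀ j, Ψ j z.1 = ev z (ψ j) := fun j => h j z
  have hx : ∀ j, totalDx (Ψ j) z.1 = ev z (Dx (ψ j)) := fun j => (h j).totalDx z
  have hy : ∀ j, totalDy (Ψ j) z.1 = ev z (Dy (ψ j)) := fun j => (h j).totalDy z
  fin_cases i <;>
  · simp [P₃, firstOrderOp, ultralocal, op, gX, g₃, b₃, Fin.sum_univ_three, Matrix.mulVec,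
      dotProduct, h0, hx, hy]
    try ring

lemma representsOp_P₄ {f₁ f₂ f₃ : (Fin 3 → ℝ) → ℝ} (hf₁ : ContDiffOn ℝ ∞ f₁ U)
    (hf₂ : ContDiffOn ℝ ∞ f₂ U) (hf₃ : ContDiffOn ℝ ∞ f₃ U) :
    RepresentsOp (P₄ + ultralocal f₁ f₂ f₃) (gX : Matrix _ _ (DiffAlg U)) g₄
      (b₄ (ofFields f₁ hf₁) (ofFields f₂ hf₂) (ofFields f₃ hf₃)) := by
  intro Ψ ψ h i z
  have h0 : ∀ j, Ψ j z.1 = ev z (ψ j) := fun j => h j z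
  have hx : ∀ j, totalDx (Ψ j) z.1 = ev z (Dx (ψ j)) := fun j => (h j).totalDx z
  have hy : ∀ j, totalDy (Ψ j) z.1 = ev z (Dy (ψ j)) := fun j => (h j).totalDy z
  fin_cases i <;>
  · simp [P₄, firstOrderOp, ultralocal, op, gX, g₄, b₄, Fin.sum_univ_three, Matrix.mulVec,
      dotProduct, h0, hx, hy]
    try ring

lemma skewAdjoint_P₃ (lam : ℝ) (F₁ F₂ F₃ : DiffAlg U) :
    SkewAdjoint gX (g₃ lam) (b₃ F₁ F₂ F₃) where
  symm₁ i j := by fin_cases i <;> fin_cases j <;> rfl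
  symm₂ i j := by fin_cases i <;> fin_cases j <;> rfl
  add_symm i j := by
    fin_cases i <;> fin_cases j <;> simp [gX, g₃, b₃] <;> module

lemma skewAdjoint_P₄ (F₁ F₂ F₃ : DiffAlg U) : SkewAdjoint gX g₄ (b₄ F₁ F₂ F₃) where
  symm₁ i j := by fin_cases i <;> fin_cases j <;> rfl
  symm₂ i j := by fin_cases i <;> fin_cases j <;> rfl
  add_symm i j := by
    fin_cases i <;> fin_cases j <;> simp [gX, g₄, b₄] <;> module

lemma autonomous_P₃ (lam : ℝ) {f₁ f₂ f₃ : (Fin 3 → ℝ) → ℝ} (hf₁ : ContDiffOn ℝ ∞ f₁ U)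
    (hf₂ : ContDiffOn ℝ ∞ f₂ U) (hf₃ : ContDiffOn ℝ ∞ f₃ U) :
    Autonomous (gX : Matrix _ _ (DiffAlg U)) (g₃ lam)
      (b₃ (ofFields f₁ hf₁) (ofFields f₂ hf₂) (ofFields f₃ hf₃)) where
  pd₁ c i j := by fin_cases i <;> fin_cases j <;> simp [gX]
  pd₂ c i j h := by fin_cases i <;> fin_cases j <;> simp [g₃, h]
  pd₀ c i j h := by
    have hc : c ∉ fieldCoords := by
      simp only [fieldCoords, Finset.mem_image, not_exists, not_and]
      exact fun s _ hs => (h s).1 hs.symm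
    fin_cases i <;> fin_cases j <;> simp [b₃, (h _).2, pd_ofFields_of_notMem _ _ hc]

lemma autonomous_P₄ {f₁ f₂ f₃ : (Fin 3 → ℝ) → ℝ} (hf₁ : ContDiffOn ℝ ∞ f₁ U)
    (hf₂ : ContDiffOn ℝ ∞ f₂ U) (hf₃ : ContDiffOn ℝ ∞ f₃ U) :
    Autonomous (gX : Matrix _ _ (DiffAlg U)) g₄
      (b₄ (ofFields f₁ hf₁) (ofFields f₂ hf₂) (ofFields f₃ hf₃)) where
  pd₁ c i j := by fin_cases i <;> fin_cases j <;> simp [gX]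
  pd₂ c i j h := by fin_cases i <;> fin_cases j <;> simp [g₄, h]
  pd₀ c i j h := by
    have hc : c ∉ fieldCoords := by
      simp only [fieldCoords, Finset.mem_image, not_exists, not_and]
      exact fun s _ hs => (h s).1 hs.symm
    fin_cases i <;> fin_cases j <;> simp [b₄, (h _).2, pd_ofFields_of_notMem _ _ hc]

/-! ### Sufficiency: the Schouten bracket is a divergence -/

/-! ### Sufficiency: the Schouten bracket is a divergence -/

lemma op_P₃ (lam : ℝ) (F₁ F₂ F₃ : DiffAlg U) (ψ : Fin 3 → DiffAlg U) :
    op gX (g₃ lam) (b₃ F₁ F₂ F₃) ψ =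
      ![Dx (ψ 2) - (2 : ℝ) • (fld 1 * Dy (ψ 0)) + fld 2 * Dy (ψ 1) + lam • Dy (ψ 2) -
          fldy 1 * ψ 0 + (2 : ℝ) • (fldy 2 * ψ 1) + F₁ * ψ 1 + F₂ * ψ 2,
        Dx (ψ 1) + fld 2 * Dy (ψ 0) + lam • Dy (ψ 1) - fldy 2 * ψ 0 - F₁ * ψ 0 + F₃ * ψ 2,
        Dx (ψ 0) + lam • Dy (ψ 0) - F₂ * ψ 0 - F₃ * ψ 1] := by
  refine funext fun i => DiffAlg.ext_ev fun z => ?_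
  fin_cases i <;>
  · simp [op, gX, g₃, b₃, Fin.sum_univ_three]
    ring

lemma op_P₄ (ψ : Fin 3 → DiffAlg U) :
    op gX g₄ (b₄ 0 0 0) ψ =
      ![Dx (ψ 2) - (2 : ℝ) • (fld 0 * Dy (ψ 0)) - (1 / 2 : ℝ) • (fld 1 * Dy (ψ 1)) +
          fld 2 * Dy (ψ 2) - fldy 0 * ψ 0 + (1 / 2 : ℝ) • (fldy 1 * ψ 1) +
          (2 : ℝ) • (fldy 2 * ψ 2),
        Dx (ψ 1) - (1 / 2 : ℝ) • (fld 1 * Dy (ψ 0)) + fld 2 * Dy (ψ 1) - fldy 1 * ψ 0 +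
          (1 / 2 : ℝ) • (fldy 2 * ψ 1),
        Dx (ψ 0) + fld 2 * Dy (ψ 0) - fldy 2 * ψ 0] := by
  refine funext fun i => DiffAlg.ext_ev fun z => ?_
  fin_cases i <;>
  · simp [op, gX, g₄, b₄, Fin.sum_univ_three]
    ring

lemma variation_P₃ (lam : ℝ) (F₁ F₂ F₃ : DiffAlg U) (φ ξ η : Fin 3 → DiffAlg U) :
    variation gX (g₃ lam) (b₃ F₁ F₂ F₃) φ ξ η =
      ξ 0 * (-(2 : ℝ) • (φ 1 * Dy (η 0)) + φ 2 * Dy (η 1) - Dy (φ 1) * η 0 +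
          (2 : ℝ) • (Dy (φ 2) * η 1) + pr φ F₁ * η 1 + pr φ F₂ * η 2) +
        ξ 1 * (φ 2 * Dy (η 0) - Dy (φ 2) * η 0 - pr φ F₁ * η 0 + pr φ F₃ * η 2) -
        ξ 2 * (pr φ F₂ * η 0 + pr φ F₃ * η 1) := by
  refine DiffAlg.ext_ev fun z => ?_
  simp [variation, gX, g₃, b₃, Fin.sum_univ_three]
  ring

lemma variation_P₄ (φ ξ η : Fin 3 → DiffAlg U) :
    variation gX g₄ (b₄ 0 0 0) φ ξ η =
      ξ 0 * (-(2 : ℝ) • (φ 0 * Dy (η 0)) - (1 / 2 : ℝ) • (φ 1 * Dy (η 1)) + φ 2 * Dy (η 2) -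
          Dy (φ 0) * η 0 + (1 / 2 : ℝ) • (Dy (φ 1) * η 1) + (2 : ℝ) • (Dy (φ 2) * η 2)) +
        ξ 1 * (-(1 / 2 : ℝ) • (φ 1 * Dy (η 0)) + φ 2 * Dy (η 1) - Dy (φ 1) * η 0 +
          (1 / 2 : ℝ) • (Dy (φ 2) * η 1)) +
        ξ 2 * (φ 2 * Dy (η 0) - Dy (φ 2) * η 0) := by
  refine DiffAlg.ext_ev fun z => ?_
  simp [variation, gX, g₄, b₄, Fin.sum_univ_three]
  ring

set_option maxHeartbeats 1000000 in
/-- The Schouten bracket of `P₃ + ω`, with `ω` as in the theorem, is a divergence. The fluxes solve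
a linear system: their terms are trilinear in `ξ, η, ζ` and of one order less than the bracket. -/
lemma functional_trivector_P₃ (lam c c1 : ℝ) (ξ η ζ : Fin 3 → DiffAlg U) :
    functional (trivector gX (g₃ lam)
      (b₃ (c • fld 0 + algebraMap ℝ _ c1) (-c • fld 1) (c • fld 2)) ξ η ζ) = 0 := by
  refine functional_eq_zero.2 ⟨
      (2 : ℝ) • (ξ 0 * η 1 * Dy (ζ 0)) + (c : ℝ) • (ξ 0 * η 1 * ζ 2) + ξ 0 * Dy (η 1) * ζ 0
      + ξ 1 * Dy (η 0) * ζ 0 + (c : ℝ) • (ξ 1 * η 2 * ζ 0) + (c : ℝ) • (ξ 2 * η 0 * ζ 1)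
      - ξ 0 * η 0 * Dy (ζ 1) - (2 : ℝ) • (ξ 0 * Dy (η 0) * ζ 1)
      - (c : ℝ) • (ξ 0 * η 2 * ζ 1) - ξ 1 * η 0 * Dy (ζ 0) - (c : ℝ) • (ξ 1 * η 0 * ζ 2)
      - (c : ℝ) • (ξ 2 * η 1 * ζ 0),
      (3 * c : ℝ) • (fld 0 * ξ 0 * η 0 * ζ 0) + (3 * c1 : ℝ) • (ξ 0 * η 0 * ζ 0)
      + (3 : ℝ) • (fldy 2 * ξ 0 * η 0 * ζ 0) + (c : ℝ) • (fld 1 * ξ 0 * η 0 * ζ 1)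
      + ξ 0 * Dx (η 0) * ζ 1 + (c : ℝ) • (fld 1 * ξ 0 * η 1 * ζ 0)
      + (2 * lam : ℝ) • (ξ 0 * η 1 * Dy (ζ 0)) + (c * lam : ℝ) • (ξ 0 * η 1 * ζ 2)
      + (2 * lam : ℝ) • (Dy (ξ 0) * η 0 * ζ 1) + (2 : ℝ) • (Dx (ξ 0) * η 0 * ζ 1)
      + (c : ℝ) • (fld 1 * ξ 1 * η 0 * ζ 0) + (2 * lam : ℝ) • (ξ 1 * Dy (η 0) * ζ 0)
      + ξ 1 * Dx (η 0) * ζ 0 + (c * lam : ℝ) • (ξ 1 * η 2 * ζ 0)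
      + (c * lam : ℝ) • (ξ 2 * η 0 * ζ 1) - fld 2 * ξ 0 * η 0 * Dy (ζ 0)
      - (lam : ℝ) • (ξ 0 * η 0 * Dy (ζ 1)) - (c : ℝ) • (fld 2 * ξ 0 * η 0 * ζ 2)
      - fld 2 * ξ 0 * Dy (η 0) * ζ 0 - (lam : ℝ) • (ξ 0 * Dy (η 0) * ζ 1)
      - (c : ℝ) • (fld 2 * ξ 0 * η 1 * ζ 1) - (lam : ℝ) • (ξ 0 * Dy (η 1) * ζ 0)
      - (2 : ℝ) • (ξ 0 * Dx (η 1) * ζ 0) - (c : ℝ) • (fld 2 * ξ 0 * η 2 * ζ 0)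
      - (c * lam : ℝ) • (ξ 0 * η 2 * ζ 1) - fld 2 * Dy (ξ 0) * η 0 * ζ 0
      - (lam : ℝ) • (Dy (ξ 0) * η 1 * ζ 0) - Dx (ξ 0) * η 1 * ζ 0
      - (lam : ℝ) • (ξ 1 * η 0 * Dy (ζ 0)) - (c : ℝ) • (fld 2 * ξ 1 * η 0 * ζ 1)
      - (c * lam : ℝ) • (ξ 1 * η 0 * ζ 2) - (c : ℝ) • (fld 2 * ξ 1 * η 1 * ζ 0)
      - (lam : ℝ) • (Dy (ξ 1) * η 0 * ζ 0) - Dx (ξ 1) * η 0 * ζ 0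
      - (c : ℝ) • (fld 2 * ξ 2 * η 0 * ζ 0) - (c * lam : ℝ) • (ξ 2 * η 1 * ζ 0), ?_⟩
  refine DiffAlg.ext_ev fun z => ?_
  simp only [trivector, variation_P₃, op_P₃]
  simp [Dx_Dy_comm]
  ring

set_option maxHeartbeats 1000000 in
/-- The Schouten bracket of `P₄` is a divergence. The fluxes are found as those for `P₃`. -/
lemma functional_trivector_P₄ (ξ η ζ : Fin 3 → DiffAlg U) :
    functional (trivector gX g₄ (b₄ 0 0 0) ξ η ζ) = 0 := by
  refine functional_eq_zero.2 ⟨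
      (1 / 2 : ℝ) • (ξ 0 * η 1 * Dy (ζ 1)) + (2 : ℝ) • (ξ 0 * η 2 * Dy (ζ 0))
      + ξ 0 * Dy (η 2) * ζ 0 + (1 / 2 : ℝ) • (ξ 1 * η 1 * Dy (ζ 0)) + ξ 1 * Dy (η 1) * ζ 0
      + ξ 2 * Dy (η 0) * ζ 0 - ξ 0 * η 0 * Dy (ζ 2) - (2 : ℝ) • (ξ 0 * Dy (η 0) * ζ 2)
      - (1 / 2 : ℝ) • (ξ 0 * Dy (η 1) * ζ 1) - ξ 1 * η 0 * Dy (ζ 1)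
      - (1 / 2 : ℝ) • (ξ 1 * Dy (η 0) * ζ 1) - ξ 2 * η 0 * Dy (ζ 0),
      (3 : ℝ) • (fldy 0 * ξ 0 * η 0 * ζ 0) + (2 : ℝ) • (fld 0 * ξ 0 * η 0 * Dy (ζ 0))
      + (1 / 2 : ℝ) • (fld 1 * ξ 0 * η 0 * Dy (ζ 1))
      + (2 : ℝ) • (fld 0 * ξ 0 * Dy (η 0) * ζ 0)
      + (1 / 2 : ℝ) • (fld 1 * ξ 0 * Dy (η 0) * ζ 1) + ξ 0 * Dx (η 0) * ζ 2
      + (1 / 2 : ℝ) • (fld 2 * ξ 0 * η 1 * Dy (ζ 1))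
      + (1 / 2 : ℝ) • (fld 1 * ξ 0 * Dy (η 1) * ζ 0)
      + (2 : ℝ) • (fld 2 * ξ 0 * η 2 * Dy (ζ 0)) + (2 : ℝ) • (fld 0 * Dy (ξ 0) * η 0 * ζ 0)
      + (2 : ℝ) • (fld 2 * Dy (ξ 0) * η 0 * ζ 2)
      + (1 / 2 : ℝ) • (fld 1 * Dy (ξ 0) * η 1 * ζ 0)
      + (1 / 2 : ℝ) • (fld 2 * Dy (ξ 0) * η 1 * ζ 1) + (2 : ℝ) • (Dx (ξ 0) * η 0 * ζ 2)
      + (1 / 2 : ℝ) • (Dx (ξ 0) * η 1 * ζ 1) + (1 / 2 : ℝ) • (fld 1 * ξ 1 * η 0 * Dy (ζ 0))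
      + (1 / 2 : ℝ) • (fld 2 * ξ 1 * Dy (η 0) * ζ 1) + ξ 1 * Dx (η 0) * ζ 1
      + (1 / 2 : ℝ) • (fld 2 * ξ 1 * η 1 * Dy (ζ 0))
      + (1 / 2 : ℝ) • (fld 2 * ξ 1 * Dy (η 1) * ζ 0)
      + (1 / 2 : ℝ) • (fld 1 * Dy (ξ 1) * η 0 * ζ 0)
      + (1 / 2 : ℝ) • (fld 2 * Dy (ξ 1) * η 0 * ζ 1) + (1 / 2 : ℝ) • (Dx (ξ 1) * η 0 * ζ 1)
      + (2 : ℝ) • (fld 2 * ξ 2 * Dy (η 0) * ζ 0) + ξ 2 * Dx (η 0) * ζ 0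
      - (3 : ℝ) • (fldy 2 * ξ 0 * η 0 * ζ 2) - fld 2 * ξ 0 * η 0 * Dy (ζ 2)
      - fld 2 * ξ 0 * Dy (η 0) * ζ 2 - (1 / 4 : ℝ) • (fld 1 * ξ 0 * η 1 * Dy (ζ 0))
      - (3 / 4 : ℝ) • (fldy 2 * ξ 0 * η 1 * ζ 1) - fld 2 * ξ 0 * Dy (η 1) * ζ 1
      - (1 / 2 : ℝ) • (ξ 0 * Dx (η 1) * ζ 1) - (3 : ℝ) • (fldy 2 * ξ 0 * η 2 * ζ 0)
      - fld 2 * ξ 0 * Dy (η 2) * ζ 0 - (2 : ℝ) • (ξ 0 * Dx (η 2) * ζ 0)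
      - (1 / 4 : ℝ) • (fld 1 * Dy (ξ 0) * η 0 * ζ 1) - fld 2 * Dy (ξ 0) * η 2 * ζ 0
      - Dx (ξ 0) * η 2 * ζ 0 - (3 / 4 : ℝ) • (fldy 2 * ξ 1 * η 0 * ζ 1)
      - fld 2 * ξ 1 * η 0 * Dy (ζ 1) - (1 / 4 : ℝ) • (fld 1 * ξ 1 * Dy (η 0) * ζ 0)
      - (3 / 4 : ℝ) • (fldy 2 * ξ 1 * η 1 * ζ 0) - (1 / 2 : ℝ) • (ξ 1 * Dx (η 1) * ζ 0)
      - fld 2 * Dy (ξ 1) * η 1 * ζ 0 - Dx (ξ 1) * η 1 * ζ 0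
      - (3 : ℝ) • (fldy 2 * ξ 2 * η 0 * ζ 0) - fld 2 * ξ 2 * η 0 * Dy (ζ 0)
      - fld 2 * Dy (ξ 2) * η 0 * ζ 0 - Dx (ξ 2) * η 0 * ζ 0, ?_⟩
  refine DiffAlg.ext_ev fun z => ?_
  simp only [trivector, variation_P₄, op_P₄]
  simp [Dx_Dy_comm]
  ring

/-! ### Necessity: the coefficients of the ultralocal term -/

/-- A function on a connected open set with constant partial derivatives is affine. -/
lemma exists_eq_affine {V : Set (Fin 3 → ℝ)} (hV : IsOpen V) (hVc : IsPreconnected V)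
    {f : (Fin 3 → ℝ) → ℝ} (hf : DifferentiableOn ℝ f V) (m : Fin 3 → ℝ)
    (h : ∀ q ∈ V, ∀ s, fderiv ℝ f q (Pi.single s 1) = m s) :
    ∃ a, ∀ q ∈ V, f q = ∑ s, m s * q s + a := by
  have hl : ∀ q, HasFDerivAt (fun q : Fin 3 → ℝ => ∑ s, m s * q s)
      (∑ s, m s • (ContinuousLinearMap.proj s : (Fin 3 → ℝ) →L[ℝ] ℝ)) q := fun q =>
    HasFDerivAt.fun_sum fun s _ => (hasFDerivAt_apply s q).const_mul (m s)
  refine hV.exists_eq_add_of_fderiv_eq hVc hf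
    (fun q _ => (hl q).differentiableAt.differentiableWithinAt) fun q hq => ?_
  rw [(hl q).fderiv]
  refine ContinuousLinearMap.coe_injective ((Pi.basisFun ℝ (Fin 3)).ext fun s => ?_)
  simp [h q hq, Pi.single_apply]

/-- If `f₁, f₂, f₃` depend on `u`, `v`, `w` only, respectively, and `∂f₁/∂u = ∂f₃/∂w`, then `∂f₁/∂u`
is constant, because a function of `u` alone equals a function of `w` alone. -/
lemma exists_affine_of_partials {V : Set (Fin 3 → ℝ)} (hV : IsOpen V) (hVc : IsPreconnected V)
    {f₁ f₃ : (Fin 3 → ℝ) → ℝ} (hf₁ : ContDiffOn ℝ ∞ f₁ V) (hf₃ : ContDiffOn ℝ ∞ f₃ V)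
    (h₁₁ : ∀ q ∈ V, fderiv ℝ f₁ q (Pi.single 1 1) = 0)
    (h₁₂ : ∀ q ∈ V, fderiv ℝ f₁ q (Pi.single 2 1) = 0)
    (h₃₀ : ∀ q ∈ V, fderiv ℝ f₃ q (Pi.single 0 1) = 0)
    (h₁₃ : ∀ q ∈ V, fderiv ℝ f₁ q (Pi.single 0 1) = fderiv ℝ f₃ q (Pi.single 2 1)) :
    ∃ c c₁, ∀ q ∈ V, fderiv ℝ f₁ q (Pi.single 0 1) = c ∧ f₁ q = c * q 0 + c₁ := by
  have hcongr : ∀ {g g' : (Fin 3 → ℝ) → ℝ}, (∀ q ∈ V, g q = g' q) → ∀ q ∈ V,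
      fderiv ℝ g q = fderiv ℝ g' q := fun h q hq =>
    Filter.EventuallyEq.fderiv_eq (Filter.mem_of_superset (hV.mem_nhds hq) h)
  obtain ⟨c, hc⟩ := exists_eq_affine (f := fun q => fderiv ℝ f₁ q (Pi.single 0 1)) hV hVc
    ((contDiffOn_fderiv_apply hV hf₁ _).differentiableOn (by simp)) 0 fun q hq s => by
      fin_cases s
      · change fderiv ℝ _ q (Pi.single 0 1) = 0
        rw [hcongr h₁₃ q hq, fderiv_fderiv_comm hV hf₃ _ _ hq, hcongr h₃₀ q hq]
        simp
      · change fderiv ℝ _ q (Pi.single 1 1) = 0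
        rw [fderiv_fderiv_comm hV hf₁ _ _ hq, hcongr h₁₁ q hq]
        simp
      · change fderiv ℝ _ q (Pi.single 2 1) = 0
        rw [fderiv_fderiv_comm hV hf₁ _ _ hq, hcongr h₁₂ q hq]
        simp
  simp only [Pi.zero_apply, zero_mul, Finset.sum_const_zero, zero_add] at hc
  obtain ⟨c₁, hc₁⟩ := exists_eq_affine hV hVc (hf₁.differentiableOn (by simp)) ![c, 0, 0]
    fun q hq s => by
      fin_cases s
      · exact hc q hq
      · exact h₁₁ q hq
      · exact h₁₂ q hq
  exact ⟨c, c₁, fun q hq => ⟨hc q hq, by simpa [Fin.sum_univ_three] using hc₁ q hq⟩⟩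

lemma pd_fldy_ofFields (f : (Fin 3 → ℝ) → ℝ) (hf : ContDiffOn ℝ ∞ f U) (s : Fin 3) :
    pd (.jet s 0 1) (ofFields f hf) = 0 :=
  pd_ofFields_of_notMem f hf (by simp [fieldCoords])

/-- The `d/dx` part of the compatibility conditions at `(i, i, k)` and `(0, 1, 2)` determines `ω` up
to constants; the `d/dy` part at `(0, 0, 1)` and `(0, 0, 2)` fixes the constants in `f₂` and
`f₃`. -/
lemma coeffs_of_trivector_P₃ (lam : ℝ) {f₁ f₂ f₃ : (Fin 3 → ℝ) → ℝ} (hf₁ : ContDiffOn ℝ ∞ f₁ U)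
    (hf₂ : ContDiffOn ℝ ∞ f₂ U) (hf₃ : ContDiffOn ℝ ∞ f₃ U)
    (hT : ∀ f g h : DiffAlg U, functional (trivector gX (g₃ lam)
      (b₃ (ofFields f₁ hf₁) (ofFields f₂ hf₂) (ofFields f₃ hf₃)) (grad f) (grad g) (grad h)) = 0)
    (hUc : IsPreconnected (U : Set (Fin 3 → ℝ))) :
    ∃ c c₁ : ℝ, ∀ q ∈ U, f₁ q = c * q 0 + c₁ ∧ f₂ q = -c * q 1 ∧ f₃ q = c * q 2 := by
  have H := fun (q : Fin 3 → ℝ) (hq : q ∈ U) =>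
    (autonomous_P₃ lam hf₁ hf₂ hf₃).compatibility hT hq
  simp only [Fin.sum_univ_three] at H
  have h₁₂ : ∀ q ∈ U, fderiv ℝ f₁ q (Pi.single 2 1) = 0 := fun q hq => by
    simpa [gX, g₃, b₃, ev_pd_ofFields, eq_comm] using H q hq 0 0 1 1 0
  have h₁₁ : ∀ q ∈ U, fderiv ℝ f₁ q (Pi.single 1 1) = 0 := fun q hq => by
    simpa [gX, g₃, b₃, ev_pd_ofFields] using H q hq 1 1 0 1 0
  have h₂₂ : ∀ q ∈ U, fderiv ℝ f₂ q (Pi.single 2 1) = 0 := fun q hq => by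
    simpa [gX, g₃, b₃, ev_pd_ofFields, eq_comm] using H q hq 0 0 2 1 0
  have h₂₀ : ∀ q ∈ U, fderiv ℝ f₂ q (Pi.single 0 1) = 0 := fun q hq => by
    simpa [gX, g₃, b₃, ev_pd_ofFields] using H q hq 2 2 0 1 0
  have h₃₀ : ∀ q ∈ U, fderiv ℝ f₃ q (Pi.single 0 1) = 0 := fun q hq => by
    simpa [gX, g₃, b₃, ev_pd_ofFields] using H q hq 2 2 1 1 0
  have h₁₃ : ∀ q ∈ U, fderiv ℝ f₁ q (Pi.single 0 1) = fderiv ℝ f₃ q (Pi.single 2 1) :=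
    fun q hq => by simpa [gX, g₃, b₃, ev_pd_ofFields] using H q hq 0 1 2 1 0
  have h₃₂ : ∀ q ∈ U, fderiv ℝ f₃ q (Pi.single 2 1) = -fderiv ℝ f₂ q (Pi.single 1 1) :=
    fun q hq => by simpa [gX, g₃, b₃, ev_pd_ofFields] using H q hq 1 2 0 1 0
  obtain ⟨c, c₁, hc⟩ := exists_affine_of_partials U.isOpen hUc hf₁ hf₃ h₁₁ h₁₂ h₃₀ h₁₃
  refine ⟨c, c₁, fun q hq => ⟨(hc q hq).2, ?_, ?_⟩⟩
  · have k := H q hq 0 0 1 0 1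
    simp [gX, g₃, b₃, ev_pd_ofFields, pd_fldy_ofFields, h₁₁ q hq, h₁₂ q hq, (hc q hq).1] at k
    linarith
  · have k := H q hq 0 0 2 0 1
    have h₂₁ : fderiv ℝ f₂ q (Pi.single 1 1) = -c := by
      linarith [h₁₃ q hq, h₃₂ q hq, (hc q hq).1]
    simp [gX, g₃, b₃, ev_pd_ofFields, pd_fldy_ofFields, h₂₀ q hq, h₂₂ q hq, h₂₁] at k
    linarith

/-- The `d/dx` part of the compatibility conditions is the same as for `P₃`. The `d/dy` part at
`(0, 0, 2)` gives `f₂ = c v / 2`, which together with `∂f₂/∂v = -c` forces `c = 0`. -/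
lemma coeffs_of_trivector_P₄ {f₁ f₂ f₃ : (Fin 3 → ℝ) → ℝ} (hf₁ : ContDiffOn ℝ ∞ f₁ U)
    (hf₂ : ContDiffOn ℝ ∞ f₂ U) (hf₃ : ContDiffOn ℝ ∞ f₃ U)
    (hT : ∀ f g h : DiffAlg U, functional (trivector gX g₄
      (b₄ (ofFields f₁ hf₁) (ofFields f₂ hf₂) (ofFields f₃ hf₃)) (grad f) (grad g) (grad h)) = 0)
    (hUc : IsConnected (U : Set (Fin 3 → ℝ))) :
    ∀ q ∈ U, f₁ q = 0 ∧ f₂ q = 0 ∧ f₃ q = 0 := by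
  have H := fun (q : Fin 3 → ℝ) (hq : q ∈ U) =>
    (autonomous_P₄ hf₁ hf₂ hf₃).compatibility hT hq
  simp only [Fin.sum_univ_three] at H
  have h₁₂ : ∀ q ∈ U, fderiv ℝ f₁ q (Pi.single 2 1) = 0 := fun q hq => by
    simpa [gX, g₄, b₄, ev_pd_ofFields, eq_comm] using H q hq 0 0 1 1 0
  have h₁₁ : ∀ q ∈ U, fderiv ℝ f₁ q (Pi.single 1 1) = 0 := fun q hq => by
    simpa [gX, g₄, b₄, ev_pd_ofFields] using H q hq 1 1 0 1 0
  have h₂₂ : ∀ q ∈ U, fderiv ℝ f₂ q (Pi.single 2 1) = 0 := fun q hq => by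
    simpa [gX, g₄, b₄, ev_pd_ofFields, eq_comm] using H q hq 0 0 2 1 0
  have h₂₀ : ∀ q ∈ U, fderiv ℝ f₂ q (Pi.single 0 1) = 0 := fun q hq => by
    simpa [gX, g₄, b₄, ev_pd_ofFields] using H q hq 2 2 0 1 0
  have h₃₀ : ∀ q ∈ U, fderiv ℝ f₃ q (Pi.single 0 1) = 0 := fun q hq => by
    simpa [gX, g₄, b₄, ev_pd_ofFields] using H q hq 2 2 1 1 0
  have h₃₁ : ∀ q ∈ U, fderiv ℝ f₃ q (Pi.single 1 1) = 0 := fun q hq => by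
    simpa [gX, g₄, b₄, ev_pd_ofFields, eq_comm] using H q hq 1 1 2 1 0
  have h₁₃ : ∀ q ∈ U, fderiv ℝ f₁ q (Pi.single 0 1) = fderiv ℝ f₃ q (Pi.single 2 1) :=
    fun q hq => by simpa [gX, g₄, b₄, ev_pd_ofFields] using H q hq 0 1 2 1 0
  have h₃₂ : ∀ q ∈ U, fderiv ℝ f₃ q (Pi.single 2 1) = -fderiv ℝ f₂ q (Pi.single 1 1) :=
    fun q hq => by simpa [gX, g₄, b₄, ev_pd_ofFields] using H q hq 1 2 0 1 0
  obtain ⟨c, c₁, hc⟩ :=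
    exists_affine_of_partials U.isOpen hUc.isPreconnected hf₁ hf₃ h₁₁ h₁₂ h₃₀ h₁₃
  have h₂₁ : ∀ q ∈ U, fderiv ℝ f₂ q (Pi.single 1 1) = -c := fun q hq => by
    linarith [h₁₃ q hq, h₃₂ q hq, (hc q hq).1]
  have hf₂' : ∀ q ∈ U, f₂ q = c / 2 * q 1 := fun q hq => by
    have k := H q hq 0 0 2 0 1
    simp [gX, g₄, b₄, ev_pd_ofFields, pd_fldy_ofFields, h₂₀ q hq, h₂₂ q hq, h₂₁ q hq] at k
    linarith
  -- comparing the two values of the `v`-derivative of `f₂`, namely `-c` and `c / 2`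
  have hc0 : c = 0 := by
    obtain ⟨q, hq⟩ := hUc.nonempty
    have hd : HasFDerivAt f₂ ((c / 2) • (ContinuousLinearMap.proj 1 : (Fin 3 → ℝ) →L[ℝ] ℝ)) q :=
      ((hasFDerivAt_apply 1 q).const_mul (c / 2)).congr_of_eventuallyEq
        (Filter.mem_of_superset (U.isOpen.mem_nhds hq) hf₂')
    have := h₂₁ q hq
    rw [hd.fderiv] at this
    simp at this
    linarith
  subst hc0
  refine fun q hq => ⟨?_, by simpa using hf₂' q hq, ?_⟩
  · have k := H q hq 0 0 1 0 1
    simp [gX, g₄, b₄, ev_pd_ofFields, pd_fldy_ofFields, h₁₁ q hq, h₁₂ q hq, (hc q hq).1] at k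
    linarith
  · have k := H q hq 0 1 2 0 1
    have h₃₂' : fderiv ℝ f₃ q (Pi.single 2 1) = 0 := by rw [← h₁₃ q hq, (hc q hq).1]
    simp [gX, g₄, b₄, ev_pd_ofFields, pd_fldy_ofFields, h₃₀ q hq, h₃₁ q hq, h₃₂',
      (hc q hq).1] at k
    linarith

end Hydro

end

theorem theorem5 (U : Set (Fin 3 → ℝ)) (hU : IsOpen U) (hUc : IsConnected U)
    (f₁ f₂ f₃ : (Fin 3 → ℝ) → ℝ)
    (hf₁ : ContDiffOn ℝ ∞ f₁ U) (hf₂ : ContDiffOn ℝ ∞ f₂ U) (hf₃ : ContDiffOn ℝ ∞ f₃ U)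
    (lam : ℝ) :
    (Hydro.IsHamiltonian U (Hydro.P₃ lam + Hydro.ultralocal f₁ f₂ f₃) ↔
      ∃ c c₁ : ℝ, ∀ q ∈ U, f₁ q = c * q 0 + c₁ ∧ f₂ q = -c * q 1 ∧ f₃ q = c * q 2) ∧
    (Hydro.IsHamiltonian U (Hydro.P₄ + Hydro.ultralocal f₁ f₂ f₃) ↔
      ∀ q ∈ U, f₁ q = 0 ∧ f₂ q = 0 ∧ f₃ q = 0) := by
  lift U to TopologicalSpace.Opens (Fin 3 → ℝ) using hU
  rw [(Hydro.representsOp_P₃ lam hf₁ hf₂ hf₃).isHamiltonian_iff_trivector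
      (Hydro.skewAdjoint_P₃ lam _ _ _),
    (Hydro.representsOp_P₄ hf₁ hf₂ hf₃).isHamiltonian_iff_trivector
      (Hydro.skewAdjoint_P₄ _ _ _)]
  refine ⟨⟨fun h => Hydro.coeffs_of_trivector_P₃ lam hf₁ hf₂ hf₃ h hUc.isPreconnected, ?_⟩,
    ⟨fun h => Hydro.coeffs_of_trivector_P₄ hf₁ hf₂ hf₃ h hUc, ?_⟩⟩
  · rintro ⟨c, c₁, h⟩ f g k
    have e₁ : Hydro.ofFields f₁ hf₁ = c • Hydro.fld 0 + algebraMap ℝ (Hydro.DiffAlg U) c₁ :=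
      Hydro.DiffAlg.ext_ev fun z => by simpa [Hydro.fields] using (h _ z.2).1
    have e₂ : Hydro.ofFields f₂ hf₂ = (-c • Hydro.fld 1 : Hydro.DiffAlg U) :=
      Hydro.DiffAlg.ext_ev fun z => by simpa [Hydro.fields] using (h _ z.2).2.1
    have e₃ : Hydro.ofFields f₃ hf₃ = (c • Hydro.fld 2 : Hydro.DiffAlg U) :=
      Hydro.DiffAlg.ext_ev fun z => by simpa [Hydro.fields] using (h _ z.2).2.2
    rw [e₁, e₂, e₃]
    exact Hydro.functional_trivector_P₃ lam c c₁ _ _ _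
  · intro h f g k
    have e₁ : Hydro.ofFields f₁ hf₁ = (0 : Hydro.DiffAlg U) :=
      Hydro.DiffAlg.ext_ev fun z => by simpa [Hydro.fields] using (h _ z.2).1
    have e₂ : Hydro.ofFields f₂ hf₂ = (0 : Hydro.DiffAlg U) :=
      Hydro.DiffAlg.ext_ev fun z => by simpa [Hydro.fields] using (h _ z.2).2.1
    have e₃ : Hydro.ofFields f₃ hf₃ = (0 : Hydro.DiffAlg U) :=
      Hydro.DiffAlg.ext_ev fun z => by simpa [Hydro.fields] using (h _ z.2).2.2
    rw [e₁, e₂, e₃]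
    exact Hydro.functional_trivector_P₄ _ _ _
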